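/- Consider one bosonic mode, i.e. a complex Hilbert space with an orthonormal Fock basis $|0\rangle,|1\rangle,|2\rangle,\dots$ and the operators $a|n\rangle=\sqrt n\,|n-1\rangle$, $a^\dagger|n\rangle=\sqrt{n+1}\,|n+1\rangle$. A state is a positive operator $\rho$ of trace one; $S(\rho)=-\operatorname{Tr}(\rho\ln\rho)\in[0,\infty]$ is its von Neumann entropy. For $\bar n\ge 0$ let $\rho^{\rm th}_{\bar n}=\sum_{n\ge 0}\frac{\bar n^n}{(1+\bar n)^{n+1}}|n\rangle\langle n|$ be the thermal state of mean photon number $\bar n$; its entropy is $g(\bar n)=(\bar n+1)\ln(\bar n+1)-\bar n\ln\bar n$, and $g:[0,\infty)\to[0,\infty)$ is a bijection. For $\gamma_+,\gamma_-\ge 0$ let $\Phi_t=e^{t\mathcal L}$, $t\ge 0$, be the single-mode gauge-covariant semigroup generated by $\mathcal L=\gamma_+\mathcal L_++\gamma_-\mathcal L_-$, where $$\mathcal L_+(\rho)=a^\dagger\rho a-\tfrac12 aa^\dagger\rho-\tfrac12\rho aa^\dagger,\qquad \mathcal L_-(\rho)=a\rho a^\dagger-\tfrac12 a^\dagger a\rho-\tfrac12\rho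 a^\dagger a .$$ That is, for a state $\rho$, $t\mapsto\Phi_t(\rho)$ is the state-valued solution of $\frac{d}{dt}\rho(t)=\mathcal L(\rho(t))$, $\rho(0)=\rho$, the equation being understood for all matrix elements in the Fock basis. Fix $\gamma_+,\gamma_-\ge 0$. **Infinitesimal statement.** For every real $S_0>0$ and every state $\rho$ with $S(\rho)=S_0$, $$\frac{d}{dt}S(\Phi_t(\rho))\Big|_{t=0}\ \ge\ \frac{d}{dt}S\big(\Phi_t(\rho^{\rm th}_{g^{-1}(S_0)})\big)\Big|_{t=0},$$ where the derivatives are derivatives from the right with values in $[-\infty,\infty]$, and the inequality is required whenever they exist. **Finite-time statement.** For every real $S_0\ge 0$, every state $\rho$ with $S(\rho)=S_0$ and every $t\ge 0$, $$S(\Phi_t(\rho))\ \ge\ S\big(\Phi_t(\rho^{\rm th}_{g^{-1}(S_0)})\big).$$ **Lemma.** If the infinitesimal statement holds for the semigroup with rates $\gamma_+,\gamma_-$, then the finite-time statement holds for the same semigroup. -/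

import Mathlib

open Filter Topology
open scoped ENNReal InnerProductSpace

noncomputable section

section Mode

variable {H : Type*} [NormedAddCommGroup H] [InnerProductSpace ℂ H] [CompleteSpace H]

/-! A single bosonic mode is a complex Hilbert space `H` together with its Fock basis
`|0⟩, |1⟩, |2⟩, …`, a Hilbert basis `fock : HilbertBasis ℕ ℂ H`. -/

/-- A density operator: positive (hence self-adjoint) with unit trace. -/
def IsDensity (fock : HilbertBasis ℕ ℂ H) (ρ : H →L[ℂ] H) : Prop :=
  ρ.IsPositive ∧ HasSum (fun n : ℕ => ⟪fock n, ρ (fock n)⟫_ℂ) 1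

/-- The von Neumann entropy `S(ρ) = -Tr(ρ ln ρ) ∈ [0, ∞]`: the trace, taken in the Fock basis, of
the operator obtained from `ρ` by the continuous functional calculus of `x ↦ -x ln x`. For a density
operator this operator is positive, so every summand is a non-negative real number. -/
def vnEntropy (fock : HilbertBasis ℕ ℂ H) (ρ : H →L[ℂ] H) : ℝ≥0∞ :=
  ∑' n : ℕ, ENNReal.ofReal (⟪fock n, (cfc Real.negMulLog ρ) (fock n)⟫_ℂ).re

/-- `g(n̄) = (n̄ + 1) ln (n̄ + 1) - n̄ ln n̄`, the entropy of the thermal state of mean photon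
number `n̄ ≥ 0` (with `0 ln 0 = 0`). -/
def thermalEntropy (nbar : ℝ) : ℝ :=
  (nbar + 1) * Real.log (nbar + 1) - nbar * Real.log nbar

/-- The thermal state `∑ₙ n̄ⁿ / (1 + n̄)ⁿ⁺¹ |n⟩⟨n|` of mean photon number `n̄ ≥ 0` (the series
converges in operator norm). -/
def thermal (fock : HilbertBasis ℕ ℂ H) (nbar : ℝ) : H →L[ℂ] H :=
  ∑' n : ℕ, ((nbar ^ n / (1 + nbar) ^ (n + 1) : ℝ) : ℂ) •
    InnerProductSpace.rankOne ℂ (fock n) (fock n)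

/-- The annihilation operator on finite-photon vectors, written in Fock coordinates:
`a|n⟩ = √n |n-1⟩` (in particular `a|0⟩ = 0`). -/
def annihilate : (ℕ →₀ ℂ) →ₗ[ℂ] (ℕ →₀ ℂ) :=
  Finsupp.linearCombination ℂ fun n : ℕ => Finsupp.single (n - 1) ((Real.sqrt n : ℝ) : ℂ)

/-- The creation operator on finite-photon vectors: `a†|n⟩ = √(n+1) |n+1⟩`. -/
def create : (ℕ →₀ ℂ) →ₗ[ℂ] (ℕ →₀ ℂ) :=
  Finsupp.linearCombination ℂ fun n : ℕ => Finsupp.single (n + 1) ((Real.sqrt (n + 1) : ℝ) : ℂ)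

/-- `⟨u|ρ|v⟩` for vectors `u`, `v` with finitely many Fock coordinates. -/
def matrixElement (fock : HilbertBasis ℕ ℂ H) (ρ : H →L[ℂ] H) (u v : ℕ →₀ ℂ) : ℂ :=
  ⟪Finsupp.linearCombination ℂ fock u, ρ (Finsupp.linearCombination ℂ fock v)⟫_ℂ

/-- `⟨u|L₊(ρ)|v⟩` with `L₊(ρ) = a†ρa - ½ aa†ρ - ½ ρaa†`, the factors to the left of `ρ` being moved
to `u` as adjoints. -/
def lindbladPlus (fock : HilbertBasis ℕ ℂ H) (ρ : H →L[ℂ] H) (u v : ℕ →₀ ℂ) : ℂ :=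
  matrixElement fock ρ (annihilate u) (annihilate v)
    - (1 / 2) * matrixElement fock ρ (annihilate (create u)) v
    - (1 / 2) * matrixElement fock ρ u (annihilate (create v))

/-- `⟨u|L₋(ρ)|v⟩` with `L₋(ρ) = aρa† - ½ a†aρ - ½ ρa†a`. -/
def lindbladMinus (fock : HilbertBasis ℕ ℂ H) (ρ : H →L[ℂ] H) (u v : ℕ →₀ ℂ) : ℂ :=
  matrixElement fock ρ (create u) (create v)
    - (1 / 2) * matrixElement fock ρ (create (annihilate u)) v
    - (1 / 2) * matrixElement fock ρ u (create (annihilate v))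

/-- `⟨u|L(ρ)|v⟩` with `L = γ₊ L₊ + γ₋ L₋`. -/
def lindblad (fock : HilbertBasis ℕ ℂ H) (γp γm : ℝ) (ρ : H →L[ℂ] H) (u v : ℕ →₀ ℂ) : ℂ :=
  (γp : ℂ) * lindbladPlus fock ρ u v + (γm : ℂ) * lindbladMinus fock ρ u v

/-- `r` is an orbit `t ↦ Φ_t(ρ) = e^{tL}(ρ)`, `t ≥ 0`, of the single-mode gauge-covariant semigroup
with rates `γ₊, γ₋`: it takes its values in the density operators and solves the master equation
`dr/dt = L(r)` tested against the Fock basis. Only the values `r t` with `t ≥ 0` matter. There is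
exactly one such orbit (on `t ≥ 0`) for each initial density operator. -/
def IsOrbit (fock : HilbertBasis ℕ ℂ H) (γp γm : ℝ) (r : ℝ → (H →L[ℂ] H)) : Prop :=
  (∀ t : ℝ, 0 ≤ t → IsDensity fock (r t)) ∧
  ∀ m n : ℕ, ∀ t : ℝ, 0 ≤ t →
    HasDerivWithinAt
      (fun s : ℝ => matrixElement fock (r s) (Finsupp.single m 1) (Finsupp.single n 1))
      (lindblad fock γp γm (r t) (Finsupp.single m 1) (Finsupp.single n 1)) (Set.Ici 0) t

/-- The derivative of `t ↦ S(r t)` at `t = 0` (from the right) exists in `[-∞, ∞]` and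
equals `d`. -/
def HasEntropyRate (fock : HilbertBasis ℕ ℂ H) (r : ℝ → (H →L[ℂ] H)) (d : EReal) : Prop :=
  Tendsto
    (fun t : ℝ => ((vnEntropy fock (r t) : EReal) - (vnEntropy fock (r 0) : EReal)) / (t : EReal))
    (𝓝[>] 0) (𝓝 d)

/-- The infinitesimal minimum output entropy conjecture for the semigroup with rates `γ₊, γ₋`:
for every input state `r 0` of entropy `S₀ > 0`, the derivative at `t = 0` of the output entropy,
whenever it exists in `[-∞, ∞]`, is at least the one for the thermal input state of
entropy `S₀`. -/
def InfinitesimalMinOutputEntropy (fock : HilbertBasis ℕ ℂ H) (γp γm : ℝ) : Prop :=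
  ∀ S₀ : ℝ, 0 < S₀ → ∀ nbar : ℝ, 0 ≤ nbar → thermalEntropy nbar = S₀ →
    ∀ r rth : ℝ → (H →L[ℂ] H),
      IsOrbit fock γp γm r → vnEntropy fock (r 0) = ENNReal.ofReal S₀ →
      IsOrbit fock γp γm rth → rth 0 = thermal fock nbar →
      ∀ d dth : EReal, HasEntropyRate fock r d → HasEntropyRate fock rth dth → dth ≤ d

/-- The minimum output entropy conjecture for the semigroup with rates `γ₊, γ₋`: for every input
state `r 0` of entropy `S₀ ≥ 0` and every `t ≥ 0`, the output entropy at time `t` is at least the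
one for the thermal input state of entropy `S₀`. -/
def MinOutputEntropy (fock : HilbertBasis ℕ ℂ H) (γp γm : ℝ) : Prop :=
  ∀ S₀ : ℝ, 0 ≤ S₀ → ∀ nbar : ℝ, 0 ≤ nbar → thermalEntropy nbar = S₀ →
    ∀ r rth : ℝ → (H →L[ℂ] H),
      IsOrbit fock γp γm r → vnEntropy fock (r 0) = ENNReal.ofReal S₀ →
      IsOrbit fock γp γm rth → rth 0 = thermal fock nbar →
      ∀ t : ℝ, 0 ≤ t → vnEntropy fock (rth t) ≤ vnEntropy fock (r t)

end Mode

end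

/-!
In the coordinate `N t = g⁻¹(S(Φ_t(ρ)))` the infinitesimal statement at the state `Φ_t(ρ)` reads
`N' ≥ γ₊ (N + 1) - γ₋ N`, wherever `N` is differentiable and positive. Thermal states stay thermal,
with mean photon number `m` solving `m' = γ₊ (m + 1) - γ₋ m`, so Grönwall's inequality for `N - m`
yields the theorem once `N` is known to be regular enough. Since `S(Φ_t(ρ))` is not known to be
differentiable, or even continuous, the regularity used is the one-sided bound
`S(Φ_s(ρ)) ≤ S(Φ_t(ρ)) + |γ₋ - γ₊| (t - s)` for `s ≤ t`: up to a linear drift `N` is monotone, hence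
differentiable almost everywhere and with increments at least the integral of its derivative.

The bound comes from the Dyson series of the master equation. Between eigenbases of `Φ_s(ρ)` and
`Φ_t(ρ)` it defines transition probabilities which carry one spectrum to the other. Their row sums
are at most `e^{(γ₋ - γ₊)(t - s)}`, because the dual semigroup scales the identity that way, and
their column sums at least one, because no photons escape to infinity: the populations follow a
birth-death process with linear rates. Concavity of `-x ln x` then applies. The same series is the
minimal solution of the master equation, so conservation of mass makes orbits unique.

For `γ₊ > 0` the value `N t = 0` does not occur at interior times `t`: the state would be pure, say
`|x⟩⟨x|`, so for `v ⊥ x` the expectation `⟨v|Φ_t(ρ)|v⟩` would be minimal, and its vanishing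
derivative forces `a v ⊥ x`. No `x ≠ 0` has this property.
-/

noncomputable section

section HilbertSchmidt

variable {𝕜 E F ι : Type*} [RCLike 𝕜] [NormedAddCommGroup E] [InnerProductSpace 𝕜 E]
  [NormedAddCommGroup F] [InnerProductSpace 𝕜 F]

theorem isCompactOperator_rankOne (x : F) (y : E) :
    IsCompactOperator (InnerProductSpace.rankOne 𝕜 x y : E →L[𝕜] F) := by
  rw [InnerProductSpace.rankOne_def']
  exact ((isCompactOperator_id (E := 𝕜)).comp_clm (innerSL 𝕜 y)).clm_comp
    (ContinuousLinearMap.toSpanSingleton 𝕜 x)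

theorem norm_sum_rankOne_le_sqrt {b : ι → E} (hb : Orthonormal 𝕜 b) (v : ι → F) (s : Finset ι) :
    ‖∑ i ∈ s, InnerProductSpace.rankOne 𝕜 (v i) (b i)‖ ≤ √(∑ i ∈ s, ‖v i‖ ^ 2) := by
  refine ContinuousLinearMap.opNorm_le_bound _ (Real.sqrt_nonneg _) fun x => ?_
  calc ‖(∑ i ∈ s, InnerProductSpace.rankOne 𝕜 (v i) (b i)) x‖
      = ‖∑ i ∈ s, inner 𝕜 (b i) x • v i‖ := by simp
    _ ≤ ∑ i ∈ s, ‖v i‖ * ‖inner 𝕜 (b i) x‖ :=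
        norm_sum_le_of_le _ fun i _ => by rw [norm_smul, mul_comm]
    _ ≤ √(∑ i ∈ s, ‖v i‖ ^ 2) * √(∑ i ∈ s, ‖inner 𝕜 (b i) x‖ ^ 2) :=
        Real.sum_mul_le_sqrt_mul_sqrt _ _ _
    _ ≤ √(∑ i ∈ s, ‖v i‖ ^ 2) * ‖x‖ := by
        gcongr
        exact Real.sqrt_le_iff.mpr ⟨norm_nonneg x, hb.sum_inner_products_le x⟩

variable [CompleteSpace F]

theorem hasSum_rankOne_of_summable_norm_sq (b : HilbertBasis ι 𝕜 E) {A : E →L[𝕜] F}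
    (hA : Summable fun i => ‖A (b i)‖ ^ 2) :
    HasSum (fun i => InnerProductSpace.rankOne 𝕜 (A (b i)) (b i)) A := by
  have hsummable : Summable fun i => InnerProductSpace.rankOne 𝕜 (A (b i)) (b i) := by
    rw [summable_iff_vanishing_norm] at hA ⊢
    intro ε hε
    obtain ⟨s, hs⟩ := hA (ε ^ 2) (by positivity)
    refine ⟨s, fun t hts => (norm_sum_rankOne_le_sqrt b.orthonormal _ t).trans_lt ?_⟩
    exact (Real.sqrt_lt' hε).mpr (lt_of_abs_lt (hs t hts))
  convert hsummable.hasSum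
  ext x
  have hBx := hsummable.hasSum.mapL (ContinuousLinearMap.apply 𝕜 F x)
  refine ((b.hasSum_repr x).mapL A).unique ?_
  simpa [b.repr_apply_apply] using hBx

theorem isCompactOperator_of_summable_norm_sq (b : HilbertBasis ι 𝕜 E) {A : E →L[𝕜] F}
    (hA : Summable fun i => ‖A (b i)‖ ^ 2) : IsCompactOperator A :=
  isCompactOperator_of_tendsto (hasSum_rankOne_of_summable_norm_sq b hA) <|
    Eventually.of_forall fun _ =>
      (compactOperator (RingHom.id 𝕜) E F).sum_mem fun _ _ => isCompactOperator_rankOne _ _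

end HilbertSchmidt

section Eigenbasis

variable {𝕜 : Type*} {H : Type*} [RCLike 𝕜] [NormedAddCommGroup H] [InnerProductSpace 𝕜 H]

theorem hasSum_norm_inner_sq {ι : Type*} (b : HilbertBasis ι 𝕜 H) (x : H) :
    HasSum (fun i => ‖inner 𝕜 (b i) x‖ ^ 2) (‖x‖ ^ 2) := by
  have h := (b.hasSum_inner_mul_inner x x).mapL RCLike.reCLM
  simp only [RCLike.reCLM_apply, inner_mul_symm_re_eq_norm, norm_mul,
    norm_inner_symm x, ← pow_two, inner_self_eq_norm_sq] at h
  exact h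

theorem exists_hilbertBasis_of_orthogonalFamily [CompleteSpace H] {κ : Type*}
    {V : κ → Submodule 𝕜 H} [∀ k, CompleteSpace (V k)]
    (hV : OrthogonalFamily 𝕜 (fun k => V k) fun k => (V k).subtypeₗᵢ) (hbot : (⨆ k, V k)ᗮ = ⊥) :
    ∃ (w : ∀ k, Set (V k)) (e : HilbertBasis (Σ k, w k) 𝕜 H), ∀ i, e i ∈ V i.1 := by
  choose w b _ using fun k => exists_hilbertBasis 𝕜 (V k)
  have horth : Orthonormal 𝕜 fun i : Σ k, w k => (b i.1 i.2 : H) :=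
    hV.orthonormal_sigma_orthonormal (v_family := fun k => b k) fun k => (b k).orthonormal
  have hspan : (Submodule.span 𝕜 (Set.range fun i : Σ k, w k => (b i.1 i.2 : H)))ᗮ = ⊥ := by
    rw [eq_bot_iff, ← hbot, ← Submodule.iInf_orthogonal, le_iInf_iff]
    intro k x hx y hy
    have hxb : ∀ i, inner 𝕜 x (b k i : H) = 0 := fun i =>
      (Submodule.mem_orthogonal' _ _).mp hx _ (Submodule.subset_span ⟨⟨k, i⟩, rfl⟩)
    have hsum := (((b k).hasSum_repr ⟨y, hy⟩).mapL (V k).subtypeL).mapL (innerSL 𝕜 x)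
    simp only [map_smul, Submodule.subtypeL_apply, innerSL_apply_apply, hxb, smul_zero] at hsum
    exact inner_eq_zero_symm.mp (hsum.unique hasSum_zero)
  refine ⟨w, HilbertBasis.mkOfOrthogonalEqBot horth hspan, fun i => ?_⟩
  rw [HilbertBasis.coe_mkOfOrthogonalEqBot]
  exact (b i.1 i.2).2

theorem isClosed_eigenspace (T : H →L[𝕜] H) (μ : 𝕜) :
    IsClosed (Module.End.eigenspace (T : Module.End 𝕜 H) μ : Set H) := by
  convert isClosed_eq T.continuous (continuous_const_smul μ)
  ext x
  exact Module.End.mem_eigenspace_iff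

theorem exists_hilbertBasis_eigenvectors [CompleteSpace H] {T : H →L[𝕜] H}
    (hc : IsCompactOperator T) (hT : T.IsSymmetric) :
    ∃ (w : ∀ μ : 𝕜, Set (Module.End.eigenspace (T : Module.End 𝕜 H) μ))
      (e : HilbertBasis (Σ μ, w μ) 𝕜 H), ∀ i, T (e i) = i.1 • e i := by
  have : ∀ μ, CompleteSpace (Module.End.eigenspace (T : Module.End 𝕜 H) μ) := fun μ =>
    (isClosed_eigenspace T μ).completeSpace_coe
  obtain ⟨w, e, he⟩ := exists_hilbertBasis_of_orthogonalFamily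
    (LinearMap.IsSymmetric.orthogonalFamily_eigenspaces hT)
    (ContinuousLinearMap.orthogonalComplement_iSup_eigenspaces_eq_bot hc hT)
  exact ⟨w, e, fun i => Module.End.mem_eigenspace_iff.mp (he i)⟩

end Eigenbasis

section Entropy

universe u

variable {H : Type*} [NormedAddCommGroup H] [InnerProductSpace ℂ H]

theorem mem_spectrum_of_apply_eq_smul {T : H →L[ℂ] H} {x : H} (hx0 : x ≠ 0) {p : ℝ}
    (hx : T x = (p : ℂ) • x) : p ∈ spectrum ℝ T := by
  rw [spectrum.mem_iff, Algebra.algebraMap_eq_smul_one]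
  rintro ⟨u, hu⟩
  have hker : (u : H →L[ℂ] H) x = 0 := by simp [hu, hx]
  have hinv := congrArg (fun S : H →L[ℂ] H => S x) u.inv_mul
  simp only [mul_apply_eq_comp, hker, map_zero, one_apply_eq_self] at hinv
  exact hx0 hinv.symm

theorem IsDensity.eigenvalue_nonneg {fock : HilbertBasis ℕ ℂ H} {ρ : H →L[ℂ] H}
    (h : IsDensity fock ρ) {ι : Type*} {e : HilbertBasis ι ℂ H} {p : ι → ℝ}
    (he : ∀ i, ρ (e i) = (p i : ℂ) • e i) (i : ι) : 0 ≤ p i := by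
  have hquad := h.1.re_inner_nonneg_right (e i)
  rwa [he, inner_smul_right, inner_self_eq_norm_sq_to_K, e.orthonormal.norm_eq_one,
    RCLike.ofReal_one, one_pow, mul_one, RCLike.re_eq_complex_re, Complex.ofReal_re] at hquad

variable [CompleteSpace H]

theorem cfcHom_apply_eigenvector {T : H →L[ℂ] H} (hT : IsSelfAdjoint T) {x : H} {p : ℝ}
    (hp : p ∈ spectrum ℝ T) (hx : T x = (p : ℂ) • x) (g : C(spectrum ℝ T, ℝ)) :
    cfcHom hT g x = (g ⟨p, hp⟩ : ℂ) • x := by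
  have : CompactSpace (spectrum ℝ T) := isCompact_iff_compactSpace.mp (spectrum.isCompact T)
  induction g using ContinuousMap.induction_on_of_compact with
  | const r =>
    rw [show ContinuousMap.const (spectrum ℝ T) r = algebraMap ℝ C(spectrum ℝ T, ℝ) r from rfl,
      AlgHomClass.commutes, Algebra.algebraMap_eq_smul_one]
    rfl
  | id => rw [cfcHom_id]; exact hx
  | star_id => rw [star_trivial, cfcHom_id]; exact hx
  | add f g hf hg =>
    rw [map_add, add_apply, hf, hg, ContinuousMap.add_apply, Complex.ofReal_add, add_smul]
  | mul f g hf hg =>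
    rw [map_mul, mul_apply_eq_comp, hg, map_smul, hf, ContinuousMap.mul_apply,
      Complex.ofReal_mul, smul_smul, mul_comm]
  | frequently f h =>
    have hclosed : IsClosed {g : C(spectrum ℝ T, ℝ) | cfcHom hT g x = (g ⟨p, hp⟩ : ℂ) • x} := by
      refine isClosed_eq ((cfcHom_continuous hT).clm_apply continuous_const) ?_
      exact (Complex.continuous_ofReal.comp (continuous_eval_const _)).smul continuous_const
    exact hclosed.mem_of_frequently_of_tendsto h tendsto_id

theorem cfc_apply_eigenvector {T : H →L[ℂ] H} (hT : IsSelfAdjoint T) {f : ℝ → ℝ}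
    (hf : ContinuousOn f (spectrum ℝ T)) {x : H} {p : ℝ} (hx : T x = (p : ℂ) • x) :
    cfc f T x = (f p : ℂ) • x := by
  rcases eq_or_ne x 0 with rfl | hx0
  · simp
  · rw [cfc_apply f T hT hf, cfcHom_apply_eigenvector hT (mem_spectrum_of_apply_eq_smul hx0 hx) hx]
    rfl

theorem hasSum_eigenvalue_mul_norm_inner_sq {A : H →L[ℂ] H} (hA : IsSelfAdjoint A) {ι : Type*}
    (e : HilbertBasis ι ℂ H) {p : ι → ℝ} (he : ∀ i, A (e i) = (p i : ℂ) • e i) (x : H) :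
    HasSum (fun i => p i * ‖⟪e i, x⟫_ℂ‖ ^ 2) (⟪x, A x⟫_ℂ).re := by
  have hcoord : ∀ i, ⟪e i, A x⟫_ℂ = p i * ⟪e i, x⟫_ℂ := fun i => by
    have hsymm : ⟪A (e i), x⟫_ℂ = ⟪e i, A x⟫_ℂ := hA.isSymmetric _ _
    rw [← hsymm, he, inner_smul_left, Complex.conj_ofReal]
  convert Complex.hasSum_re (e.hasSum_inner_mul_inner x (A x)) using 2 with i
  rw [hcoord, mul_left_comm, Complex.re_ofReal_mul, ← RCLike.re_eq_complex_re,
    inner_mul_symm_re_eq_norm, norm_mul, norm_inner_symm x, pow_two]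

theorem tsum_ofReal_inner_eq_tsum_eigenvalue {κ ι : Type*} (b : HilbertBasis κ ℂ H)
    {A : H →L[ℂ] H} (hA : IsSelfAdjoint A) (e : HilbertBasis ι ℂ H) {p : ι → ℝ}
    (he : ∀ i, A (e i) = (p i : ℂ) • e i) (hp : ∀ i, 0 ≤ p i) :
    ∑' n, ENNReal.ofReal (⟪b n, A (b n)⟫_ℂ).re = ∑' i, ENNReal.ofReal (p i) := by
  have hquad : ∀ x : H, ENNReal.ofReal (⟪x, A x⟫_ℂ).re
      = ∑' i, ENNReal.ofReal (p i) * ENNReal.ofReal (‖⟪e i, x⟫_ℂ‖ ^ 2) := fun x => by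
    have h := hasSum_eigenvalue_mul_norm_inner_sq hA e he x
    rw [← h.tsum_eq, ENNReal.ofReal_tsum_of_nonneg (fun i => mul_nonneg (hp i) (by positivity))
      h.summable]
    exact tsum_congr fun i => ENNReal.ofReal_mul (hp i)
  have hunit : ∀ i, ∑' n, ENNReal.ofReal (‖⟪e i, b n⟫_ℂ‖ ^ 2) = 1 := fun i => by
    have h := hasSum_norm_inner_sq b (e i)
    simp only [e.orthonormal.norm_eq_one, norm_inner_symm (b _)] at h
    rw [← ENNReal.ofReal_tsum_of_nonneg (fun _ => by positivity) h.summable, h.tsum_eq]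
    simp
  simp only [hquad]
  rw [ENNReal.tsum_comm]
  simp only [ENNReal.tsum_mul_left, hunit, mul_one]

variable {fock : HilbertBasis ℕ ℂ H} {ρ : H →L[ℂ] H}

theorem IsDensity.isCompactOperator (h : IsDensity fock ρ) : IsCompactOperator ρ := by
  set A := CFC.sqrt ρ
  have hA : IsSelfAdjoint A := (CFC.sqrt_nonneg ρ).isSelfAdjoint
  have hAA : A * A = ρ :=
    CFC.sqrt_mul_sqrt_self ρ ((ContinuousLinearMap.nonneg_iff_isPositive ρ).mpr h.1)
  have hnorm : ∀ n, ‖A (fock n)‖ ^ 2 = (⟪fock n, ρ (fock n)⟫_ℂ).re := fun n => by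
    have hsymm : ⟪A (fock n), A (fock n)⟫_ℂ = ⟪fock n, A (A (fock n))⟫_ℂ := hA.isSymmetric _ _
    rw [← hAA, mul_apply_eq_comp, ← hsymm]
    exact (inner_self_eq_norm_sq (𝕜 := ℂ) _).symm
  rw [← hAA]
  refine (isCompactOperator_of_summable_norm_sq fock ?_).clm_comp A
  simpa only [hnorm] using (Complex.hasSum_re h.2).summable

theorem IsDensity.exists_eigenbasis {H : Type u} [NormedAddCommGroup H] [InnerProductSpace ℂ H]
    [CompleteSpace H] {fock : HilbertBasis ℕ ℂ H} {ρ : H →L[ℂ] H} (h : IsDensity fock ρ) :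
    ∃ (ι : Type u) (e : HilbertBasis ι ℂ H) (p : ι → ℝ), ∀ i, ρ (e i) = (p i : ℂ) • e i := by
  obtain ⟨w, e, he⟩ := exists_hilbertBasis_eigenvectors h.isCompactOperator h.1.isSymmetric
  refine ⟨_, e, fun i => i.1.re, fun i => ?_⟩
  have heig : Module.End.HasEigenvalue (ρ : Module.End ℂ H) i.1 :=
    Module.End.hasEigenvalue_of_hasEigenvector
      ⟨Module.End.mem_eigenspace_iff.mpr (he i), e.orthonormal.ne_zero i⟩
  rw [Complex.conj_eq_iff_re.mp (h.1.isSymmetric.conj_eigenvalue_eq_self heig), he]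

section Eigenvalues

variable {ι : Type*} {e : HilbertBasis ι ℂ H} {p : ι → ℝ}

theorem IsDensity.hasSum_eigenvalue (h : IsDensity fock ρ)
    (he : ∀ i, ρ (e i) = (p i : ℂ) • e i) : HasSum p 1 := by
  have hp := h.eigenvalue_nonneg he
  have hre := Complex.hasSum_re h.2
  have hdiag : ∀ n, 0 ≤ (⟪fock n, ρ (fock n)⟫_ℂ).re := fun n =>
    h.1.re_inner_nonneg_right (fock n)
  have htsum : ∑' i, ENNReal.ofReal (p i) = 1 := by
    rw [← tsum_ofReal_inner_eq_tsum_eigenvalue fock h.1.isSelfAdjoint e he hp,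
      ← ENNReal.ofReal_tsum_of_nonneg hdiag hre.summable, hre.tsum_eq, Complex.one_re,
      ENNReal.ofReal_one]
  have hsummable : Summable p := by
    simpa only [ENNReal.toReal_ofReal (hp _)] using
      ENNReal.summable_toReal (htsum.trans_ne ENNReal.one_ne_top)
  rw [← ENNReal.ofReal_tsum_of_nonneg hp hsummable, ENNReal.ofReal_eq_one] at htsum
  exact htsum ▸ hsummable.hasSum

theorem IsDensity.negMulLog_eigenvalue_nonneg (h : IsDensity fock ρ)
    (he : ∀ i, ρ (e i) = (p i : ℂ) • e i) (i : ι) : 0 ≤ Real.negMulLog (p i) :=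
  Real.negMulLog_nonneg (h.eigenvalue_nonneg he i)
    (le_hasSum (h.hasSum_eigenvalue he) i fun j _ => h.eigenvalue_nonneg he j)

theorem IsDensity.vnEntropy_eq_tsum_negMulLog (h : IsDensity fock ρ)
    (he : ∀ i, ρ (e i) = (p i : ℂ) • e i) :
    vnEntropy fock ρ = ∑' i, ENNReal.ofReal (Real.negMulLog (p i)) :=
  tsum_ofReal_inner_eq_tsum_eigenvalue fock (cfc_predicate _ _) e
    (fun i => cfc_apply_eigenvector h.1.isSelfAdjoint Real.continuous_negMulLog.continuousOn (he i))
    (h.negMulLog_eigenvalue_nonneg he)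

end Eigenvalues

end Entropy

section Duhamel

variable {E : Type*} [NormedAddCommGroup E] [NormedSpace ℝ E]

/-- Duhamel's formula for the solution of `y' = f - κ y`, `y 0 = x`. -/
def duhamel (κ : ℝ) (x : E) (f : ℝ → E) (t : ℝ) : E :=
  Real.exp (-(κ * t)) • (x + ∫ s in (0 : ℝ)..t, Real.exp (κ * s) • f s)

variable {κ : ℝ} {x x' : E} {f f' : ℝ → E} {t : ℝ}

theorem duhamel_zero_right (κ : ℝ) (x : E) (f : ℝ → E) : duhamel κ x f 0 = x := by
  simp [duhamel]

theorem duhamel_congr {f f' : ℝ → E} (ht : 0 ≤ t) (h : ∀ s, 0 ≤ s → s ≤ t → f s = f' s) :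
    duhamel κ x f t = duhamel κ x f' t := by
  rw [duhamel, duhamel, intervalIntegral.integral_congr fun s hs => ?_]
  rw [Set.uIcc_of_le ht] at hs
  simp only [h s hs.1 hs.2]

theorem duhamel_eq_add_integral (κ : ℝ) (x : E) (f : ℝ → E) (t : ℝ) :
    duhamel κ x f t
      = Real.exp (-(κ * t)) • x + ∫ s in (0 : ℝ)..t, Real.exp (-(κ * (t - s))) • f s := by
  rw [duhamel, smul_add, ← intervalIntegral.integral_smul]
  simp only [smul_smul, ← Real.exp_add]
  congr! 5
  ring

theorem intervalIntegrable_exp_smul (κ : ℝ) (hf : ContinuousOn f (Set.Ici 0)) (ht : 0 ≤ t) :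
    IntervalIntegrable (fun s => Real.exp (κ * s) • f s) MeasureTheory.volume 0 t :=
  ContinuousOn.intervalIntegrable_of_Icc ht
    (ContinuousOn.smul (by fun_prop) (hf.mono Set.Icc_subset_Ici_self))

theorem duhamel_add_smul (c : ℝ) (hf : ContinuousOn f (Set.Ici 0))
    (hf' : ContinuousOn f' (Set.Ici 0)) (ht : 0 ≤ t) :
    duhamel κ (x + c • x') (fun s => f s + c • f' s) t
      = duhamel κ x f t + c • duhamel κ x' f' t := by
  simp only [duhamel, smul_add, smul_comm _ c]
  have hint := intervalIntegral.integral_add (intervalIntegrable_exp_smul κ hf ht)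
    ((intervalIntegrable_exp_smul κ hf' ht).smul c)
  simp only [Pi.smul_apply, intervalIntegral.integral_smul] at hint
  rw [hint]
  module

theorem duhamel_mono {x x' : ℝ} {f f' : ℝ → ℝ} (hf : ContinuousOn f (Set.Ici 0))
    (hf' : ContinuousOn f' (Set.Ici 0)) (ht : 0 ≤ t) (hx : x ≤ x')
    (h : ∀ s, 0 ≤ s → f s ≤ f' s) : duhamel κ x f t ≤ duhamel κ x' f' t := by
  have := intervalIntegral.integral_mono_on ht (intervalIntegrable_exp_smul κ hf ht)
    (intervalIntegrable_exp_smul κ hf' ht) fun s hs =>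
      smul_le_smul_of_nonneg_left (h s hs.1) (Real.exp_nonneg _)
  unfold duhamel
  gcongr

variable [CompleteSpace E]

theorem hasDerivAt_exp_mul (κ t : ℝ) :
    HasDerivAt (fun s => Real.exp (κ * s)) (κ * Real.exp (κ * t)) t := by
  simpa [mul_comm] using ((hasDerivAt_id t).const_mul κ).exp

theorem hasDerivAt_duhamel (hf : Continuous f) (κ : ℝ) (x : E) (t : ℝ) :
    HasDerivAt (duhamel κ x f) (f t - κ • duhamel κ x f t) t := by
  have hcont : Continuous fun s => Real.exp (κ * s) • f s := by fun_prop
  have hintegral := (hcont.integral_hasStrictDerivAt 0 t).hasDerivAt.const_add x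
  have hexp := hasDerivAt_exp_mul (-κ) t
  simp only [neg_mul] at hexp
  refine (hexp.smul hintegral).congr_deriv ?_
  rw [smul_smul, ← Real.exp_add, neg_add_cancel, Real.exp_zero, duhamel]
  module

theorem eq_duhamel_of_hasDerivWithinAt {y : ℝ → E} (hf : ContinuousOn f (Set.Ici 0))
    (hy : ∀ s, 0 ≤ s → HasDerivWithinAt y (f s - κ • y s) (Set.Ici 0) s) (ht : 0 ≤ t) :
    y t = duhamel κ (y 0) f t := by
  have hderiv : ∀ s, 0 ≤ s → HasDerivWithinAt (fun s => Real.exp (κ * s) • y s)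
      (Real.exp (κ * s) • f s) (Set.Ici 0) s := fun s hs =>
    ((hasDerivAt_exp_mul κ s).hasDerivWithinAt.smul (hy s hs)).congr_deriv (by module)
  have hintegral := intervalIntegral.integral_eq_sub_of_hasDeriv_right_of_le ht
    (fun s hs => (hderiv s hs.1).continuousWithinAt.mono Set.Icc_subset_Ici_self)
    (fun s hs => (hderiv s hs.1.le).mono fun u hu => (hs.1.trans hu).le)
    (intervalIntegrable_exp_smul κ hf ht)
  rw [duhamel, hintegral, mul_zero, Real.exp_zero, one_smul, add_sub_cancel, smul_smul,
    ← Real.exp_add, neg_add_cancel, Real.exp_zero, one_smul]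

theorem re_duhamel {x : ℂ} {f : ℝ → ℂ} (hf : ContinuousOn f (Set.Ici 0)) (ht : 0 ≤ t) :
    (duhamel κ x f t).re = duhamel κ x.re (fun s => (f s).re) t := by
  have h := Complex.reCLM.intervalIntegral_comp_comm (intervalIntegrable_exp_smul κ hf ht)
  simp only [Complex.reCLM_apply, Complex.smul_re] at h
  rw [duhamel, duhamel, Complex.smul_re, Complex.add_re, h]

end Duhamel

section PosSemidef

open scoped ComplexOrder
open Matrix

variable {ι 𝕜 : Type*} [RCLike 𝕜]

theorem posSemidef_mul_star (a : ι → 𝕜) :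
    (Matrix.of fun j k => a j * star (a k)).PosSemidef := by
  refine ⟨Matrix.ext fun j k => by simp [mul_comm], fun v => ?_⟩
  have hsquare : v.sum (fun j vj => v.sum fun k vk => star vj * (a j * star (a k)) * vk)
      = star (v.sum fun k vk => star (a k) * vk) * v.sum fun k vk => star (a k) * vk := by
    simp only [Finsupp.sum, star_sum, star_mul, star_star, Finset.sum_mul_sum, mul_assoc]
  simp only [of_apply, hsquare]
  exact star_mul_self_nonneg _

theorem posSemidef_mul_smul {X : Matrix ι ι 𝕜} (hX : X.PosSemidef) (w : ι → ℝ) :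
    (Matrix.of fun j k => (w j * w k) • X j k).PosSemidef := by
  convert hX.hadamard (posSemidef_mul_star fun j => (w j : 𝕜)) using 1
  ext j k
  simp only [of_apply, hadamard_apply, RCLike.star_def, RCLike.conj_ofReal,
    RCLike.real_smul_eq_coe_mul, RCLike.ofReal_mul]
  ring

theorem posSemidef_integral {α : Type*} [MeasurableSpace α] {μ : MeasureTheory.Measure α}
    {M : α → Matrix ι ι 𝕜} (hM : ∀ j k, MeasureTheory.Integrable (fun s => M s j k) μ)
    (hpos : ∀ᵐ s ∂μ, (M s).PosSemidef) :
    (Matrix.of fun j k => ∫ s, M s j k ∂μ).PosSemidef := by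
  refine ⟨Matrix.ext fun j k => ?_, fun v => ?_⟩
  · simp only [conjTranspose_apply, of_apply, RCLike.star_def, ← integral_conj]
    refine MeasureTheory.integral_congr_ae (hpos.mono fun s hs => ?_)
    exact hs.isHermitian.apply j k
  · have hterm : ∀ j k, MeasureTheory.Integrable (fun s => star (v j) * M s j k * v k) μ :=
      fun j k => ((hM j k).const_mul _).mul_const _
    have hint : v.sum (fun j vj => v.sum fun k vk => star vj * (∫ s, M s j k ∂μ) * vk)
        = ∫ s, v.sum (fun j vj => v.sum fun k vk => star vj * M s j k * vk) ∂μ := by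
      simp only [Finsupp.sum]
      rw [MeasureTheory.integral_finsetSum _ fun j _ =>
        MeasureTheory.integrable_finsetSum _ fun k _ => hterm j k]
      refine Finset.sum_congr rfl fun j _ => ?_
      rw [MeasureTheory.integral_finsetSum _ fun k _ => hterm j k]
      refine Finset.sum_congr rfl fun k _ => ?_
      rw [MeasureTheory.integral_mul_const, MeasureTheory.integral_const_mul]
    simp only [of_apply, hint]
    exact MeasureTheory.integral_nonneg_of_ae (hpos.mono fun s hs => hs.2 v)

end PosSemidef

section MasterEquation

open scoped ComplexOrder
open Matrix

/-- The rate `γ₊ (l + 1) + γ₋ l` at which the Fock level `l` is left. -/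
def lossRate (γp γm : ℝ) (l : ℕ) : ℝ := γp * (l + 1) + γm * l

/-- The decay rate of the matrix element `(j, k)`. -/
def decayRate (γp γm : ℝ) (j k : ℕ) : ℝ := (lossRate γp γm j + lossRate γp γm k) / 2

/-- The jump part `γ₊ a†Xa + γ₋ aXa†` of the generator, on matrices in the Fock basis. -/
def gain (γp γm : ℝ) (X : Matrix ℕ ℕ ℂ) : Matrix ℕ ℕ ℂ := Matrix.of fun j k =>
  (γp * (√j * √k)) • X (j - 1) (k - 1) + (γm * (√(j + 1) * √(k + 1))) • X (j + 1) (k + 1)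

/-- The master equation for matrices in the Fock basis, entry by entry. -/
def IsMasterSolution (γp γm : ℝ) (Y : ℝ → Matrix ℕ ℕ ℂ) : Prop :=
  ∀ j k t, 0 ≤ t → HasDerivWithinAt (fun s => Y s j k)
    (gain γp γm (Y t) j k - decayRate γp γm j k • Y t j k) (Set.Ici 0) t

/-- The right-hand side of the integrated master equation with initial matrix `X`. -/
def picard (γp γm : ℝ) (X : Matrix ℕ ℕ ℂ) (Y : ℝ → Matrix ℕ ℕ ℂ) (t : ℝ) : Matrix ℕ ℕ ℂ :=
  Matrix.of fun j k => duhamel (decayRate γp γm j k) (X j k) (fun s => gain γp γm (Y s) j k) t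

/-- The partial sums of the Dyson series of the master equation: the contribution to the solution
started in `X` of at most `n - 1` jumps. -/
def dyson (γp γm : ℝ) (X : Matrix ℕ ℕ ℂ) : ℕ → ℝ → Matrix ℕ ℕ ℂ
  | 0 => 0
  | n + 1 => picard γp γm X (dyson γp γm X n)

variable {γp γm : ℝ} {X X' : Matrix ℕ ℕ ℂ} {Y Y' : ℝ → Matrix ℕ ℕ ℂ} {t : ℝ}

theorem gain_add_smul (X X' : Matrix ℕ ℕ ℂ) (c : ℝ) :
    gain γp γm (X + c • X') = gain γp γm X + c • gain γp γm X' := by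
  ext j k
  simp only [gain, of_apply, Matrix.add_apply, Matrix.smul_apply]
  module

theorem gain_posSemidef (hγp : 0 ≤ γp) (hγm : 0 ≤ γm) (hX : X.PosSemidef) :
    (gain γp γm X).PosSemidef := by
  have hup := (posSemidef_mul_smul (hX.submatrix fun j : ℕ => j - 1) fun j => √j).smul hγp
  have hdown := (posSemidef_mul_smul (hX.submatrix fun j : ℕ => j + 1) fun j => √(j + 1)).smul hγm
  have heq : gain γp γm X = γp • (Matrix.of fun j k : ℕ => (√j * √k) • X (j - 1) (k - 1))
      + γm • (Matrix.of fun j k : ℕ => (√(j + 1) * √(k + 1)) • X (j + 1) (k + 1)) := by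
    ext j k
    simp only [gain, mul_smul, of_apply, Matrix.add_apply, Matrix.smul_apply]
  rw [heq]
  exact hup.add hdown

theorem continuousOn_gain {s : Set ℝ} (hY : ∀ j k, ContinuousOn (fun t => Y t j k) s) (j k : ℕ) :
    ContinuousOn (fun t => gain γp γm (Y t) j k) s :=
  ((hY (j - 1) (k - 1)).const_smul (γp * (√j * √k))).add
    ((hY (j + 1) (k + 1)).const_smul (γm * (√(j + 1) * √(k + 1))))

theorem posSemidef_decay (hX : X.PosSemidef) (t : ℝ) :
    (Matrix.of fun j k => Real.exp (-(decayRate γp γm j k * t)) • X j k).PosSemidef := by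
  have heq : ∀ j k, Real.exp (-(decayRate γp γm j k * t))
      = Real.exp (-(lossRate γp γm j * t / 2)) * Real.exp (-(lossRate γp γm k * t / 2)) := by
    intro j k
    rw [← Real.exp_add, decayRate]
    congr 1
    ring
  simp only [heq]
  exact posSemidef_mul_smul hX _

theorem picard_posSemidef (hγp : 0 ≤ γp) (hγm : 0 ≤ γm) (hX : X.PosSemidef)
    (hY : ∀ j k, ContinuousOn (fun s => Y s j k) (Set.Ici 0))
    (hpos : ∀ s, 0 ≤ s → (Y s).PosSemidef) (ht : 0 ≤ t) : (picard γp γm X Y t).PosSemidef := by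
  have hint : (Matrix.of fun j k => ∫ s in (0 : ℝ)..t,
      Real.exp (-(decayRate γp γm j k * (t - s))) • gain γp γm (Y s) j k).PosSemidef := by
    simp only [intervalIntegral.integral_of_le ht]
    refine posSemidef_integral (M := fun s => Matrix.of fun j k =>
      Real.exp (-(decayRate γp γm j k * (t - s))) • gain γp γm (Y s) j k) (fun j k => ?_) ?_
    · refine (ContinuousOn.integrableOn_Icc ?_).mono_set Set.Ioc_subset_Icc_self
      exact ContinuousOn.smul (by fun_prop) ((continuousOn_gain hY j k).mono
        Set.Icc_subset_Ici_self)
    · refine (MeasureTheory.ae_restrict_mem measurableSet_Ioc).mono fun s hs => ?_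
      exact posSemidef_decay (gain_posSemidef hγp hγm (hpos s hs.1.le)) (t - s)
  convert (posSemidef_decay hX t).add hint using 1
  exact Matrix.ext fun j k => duhamel_eq_add_integral _ _ _ _

theorem picard_add_smul (c : ℝ) (hY : ∀ j k, ContinuousOn (fun s => Y s j k) (Set.Ici 0))
    (hY' : ∀ j k, ContinuousOn (fun s => Y' s j k) (Set.Ici 0)) (ht : 0 ≤ t) :
    picard γp γm (X + c • X') (fun s => Y s + c • Y' s) t
      = picard γp γm X Y t + c • picard γp γm X' Y' t := by
  ext j k
  simp only [picard, gain_add_smul]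
  exact duhamel_add_smul c (continuousOn_gain hY j k) (continuousOn_gain hY' j k) ht

theorem continuous_dyson (X : Matrix ℕ ℕ ℂ) (n j k : ℕ) :
    Continuous fun t => dyson γp γm X n t j k := by
  induction n generalizing j k with
  | zero => exact continuous_const
  | succ n ih =>
    have hgain : Continuous fun s => gain γp γm (dyson γp γm X n s) j k :=
      continuousOn_univ.mp (continuousOn_gain (fun j k => (ih j k).continuousOn) j k)
    exact continuous_iff_continuousAt.mpr fun t => (hasDerivAt_duhamel hgain _ _ t).continuousAt

theorem dyson_posSemidef (hγp : 0 ≤ γp) (hγm : 0 ≤ γm) (hX : X.PosSemidef) (n : ℕ) (ht : 0 ≤ t) :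
    (dyson γp γm X n t).PosSemidef := by
  induction n generalizing t with
  | zero => exact PosSemidef.zero
  | succ n ih =>
    exact picard_posSemidef hγp hγm hX (fun j k => (continuous_dyson X n j k).continuousOn)
      (fun s hs => ih hs) ht

theorem dyson_add_smul (X X' : Matrix ℕ ℕ ℂ) (c : ℝ) (n : ℕ) (ht : 0 ≤ t) :
    dyson γp γm (X + c • X') n t = dyson γp γm X n t + c • dyson γp γm X' n t := by
  induction n generalizing t with
  | zero => simp [dyson]
  | succ n ih =>
    simp only [dyson]
    rw [← picard_add_smul c (fun j k => (continuous_dyson X n j k).continuousOn)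
      (fun j k => (continuous_dyson X' n j k).continuousOn) ht]
    ext j k
    exact duhamel_congr ht fun s hs _ => by rw [ih hs]

theorem isLinearMap_dyson (n : ℕ) (ht : 0 ≤ t) :
    IsLinearMap ℝ fun X => dyson γp γm X n t where
  map_add X X' := by simpa using dyson_add_smul X X' 1 n ht
  map_smul c X := by
    have hzero : dyson γp γm 0 n t = 0 := by
      simpa using dyson_add_smul (γp := γp) (γm := γm) 0 0 1 n ht
    simpa [hzero] using dyson_add_smul (γp := γp) (γm := γm) 0 X c n ht

theorem IsMasterSolution.continuousOn (hY : IsMasterSolution γp γm Y) (j k : ℕ) :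
    ContinuousOn (fun t => Y t j k) (Set.Ici 0) :=
  fun t ht => (hY j k t ht).continuousWithinAt

theorem IsMasterSolution.eq_picard (hY : IsMasterSolution γp γm Y) (ht : 0 ≤ t) :
    Y t = picard γp γm (Y 0) Y t := by
  ext j k
  exact eq_duhamel_of_hasDerivWithinAt (y := fun s => Y s j k)
    (continuousOn_gain hY.continuousOn j k) (hY j k) ht

theorem IsMasterSolution.sub_dyson_posSemidef (hγp : 0 ≤ γp) (hγm : 0 ≤ γm)
    (hY : IsMasterSolution γp γm Y) (hpos : ∀ s, 0 ≤ s → (Y s).PosSemidef)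
    (hX : (Y 0 - X).PosSemidef) (n : ℕ) (ht : 0 ≤ t) :
    (Y t - dyson γp γm X n t).PosSemidef := by
  induction n generalizing t with
  | zero => simpa [dyson] using hpos t ht
  | succ n ih =>
    have hcont : ∀ j k, ContinuousOn (fun s => dyson γp γm X n s j k) (Set.Ici 0) :=
      fun j k => (continuous_dyson X n j k).continuousOn
    have hsub := picard_add_smul (γp := γp) (γm := γm) (X := Y 0) (X' := X) (-1)
      hY.continuousOn hcont ht
    simp only [neg_smul, one_smul, ← sub_eq_add_neg, ← hY.eq_picard ht] at hsub
    rw [dyson, ← hsub]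
    exact picard_posSemidef hγp hγm hX (fun j k => (hY.continuousOn j k).sub (hcont j k))
      (fun s hs => ih hs) ht

theorem gain_one (γp γm : ℝ) :
    gain γp γm 1 = Matrix.of fun j k =>
      (γm - γp + decayRate γp γm j k) • (1 : Matrix ℕ ℕ ℂ) j k := by
  ext j k
  rcases eq_or_ne j k with rfl | hjk
  · simp only [gain, of_apply, one_apply_eq, decayRate, lossRate, Real.mul_self_sqrt
      (Nat.cast_nonneg (α := ℝ) j), Real.mul_self_sqrt (Nat.cast_add_one_pos (α := ℝ) j).le,
      ← add_smul]
    congr 1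
    ring
  · have hup : (√j * √k) • (1 : Matrix ℕ ℕ ℂ) (j - 1) (k - 1) = 0 := by
      by_cases h : j - 1 = k - 1
      · rcases (by omega : j = 0 ∨ k = 0) with rfl | rfl <;> simp
      · simp [one_apply_ne h]
    simp only [gain, of_apply, mul_smul γp, hup, one_apply_ne hjk,
      one_apply_ne (Nat.succ_injective.ne hjk), smul_zero, add_zero]

theorem isMasterSolution_exp_smul_one (γp γm : ℝ) :
    IsMasterSolution γp γm fun t => Real.exp ((γm - γp) * t) • 1 := by
  intro j k t _
  have hgain := gain_add_smul (γp := γp) (γm := γm) 0 1 (Real.exp ((γm - γp) * t))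
  have hzero : gain γp γm 0 = 0 := by ext; simp [gain]
  rw [zero_add, hzero, zero_add, gain_one] at hgain
  rw [hgain]
  refine (((hasDerivAt_exp_mul (γm - γp) t).smul_const
    ((1 : Matrix ℕ ℕ ℂ) j k)).hasDerivWithinAt).congr_deriv ?_
  simp only [Matrix.smul_apply, of_apply]
  module

theorem exp_smul_one_sub_dyson_posSemidef (hγp : 0 ≤ γp) (hγm : 0 ≤ γm)
    (hX : (1 - X).PosSemidef) (n : ℕ) (ht : 0 ≤ t) :
    (Real.exp ((γm - γp) * t) • (1 : Matrix ℕ ℕ ℂ) - dyson γp γm X n t).PosSemidef :=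
  (isMasterSolution_exp_smul_one γp γm).sub_dyson_posSemidef hγp hγm
    (fun _ _ => PosSemidef.one.smul (Real.exp_nonneg _)) (by simpa using hX) n ht

end MasterEquation

section Population

/-- The gain part of the rate equation for the Fock populations, a birth-death process with birth
rates `γ₊ (l + 1)` and death rates `γ₋ l`. -/
def populationGain (γp γm : ℝ) (y : ℕ → ℝ) (l : ℕ) : ℝ :=
  γp * l * y (l - 1) + γm * (l + 1) * y (l + 1)

/-- The Fock populations of the partial sums of the Dyson series: the contribution to the solution
of the rate equation started in `x` of at most `n - 1` jumps. -/
def population (γp γm : ℝ) (x : ℕ → ℝ) : ℕ → ℝ → ℕ → ℝ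
  | 0 => 0
  | n + 1 => fun t l =>
    duhamel (lossRate γp γm l) (x l) (fun s => populationGain γp γm (population γp γm x n s) l) t

variable {γp γm : ℝ} {x y : ℕ → ℝ} {t : ℝ}

theorem re_dyson_diag (X : Matrix ℕ ℕ ℂ) (n l : ℕ) (ht : 0 ≤ t) :
    (dyson γp γm X n t l l).re = population γp γm (fun l => (X l l).re) n t l := by
  induction n generalizing t l with
  | zero => rfl
  | succ n ih =>
    have hgain := continuousOn_gain (γp := γp) (γm := γm) (s := Set.Ici 0)
      (fun j k => (continuous_dyson (γp := γp) (γm := γm) X n j k).continuousOn) l l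
    have hdecay : decayRate γp γm l l = lossRate γp γm l := add_self_div_two _
    refine (re_duhamel hgain ht).trans ?_
    rw [hdecay]
    refine duhamel_congr ht fun s hs _ => ?_
    simp only [gain, Matrix.of_apply, Complex.add_re, Complex.smul_re, ih _ hs, smul_eq_mul,
      Real.mul_self_sqrt (Nat.cast_nonneg (α := ℝ) l),
      Real.mul_self_sqrt (Nat.cast_add_one_pos (α := ℝ) l).le, populationGain]

theorem continuous_population (x : ℕ → ℝ) (n l : ℕ) :
    Continuous fun t => population γp γm x n t l := by
  induction n generalizing l with
  | zero => exact continuous_const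
  | succ n ih =>
    have hgain : Continuous fun s => populationGain γp γm (population γp γm x n s) l :=
      ((ih (l - 1)).const_mul _).add ((ih (l + 1)).const_mul _)
    exact continuous_iff_continuousAt.mpr fun t => (hasDerivAt_duhamel hgain _ _ t).continuousAt

theorem continuous_populationGain (x : ℕ → ℝ) (n l : ℕ) :
    Continuous fun t => populationGain γp γm (population γp γm x n t) l :=
  ((continuous_population x n (l - 1)).const_mul _).add
    ((continuous_population x n (l + 1)).const_mul _)

theorem hasDerivAt_population_succ (x : ℕ → ℝ) (n : ℕ) (t : ℝ) (l : ℕ) :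
    HasDerivAt (fun t => population γp γm x (n + 1) t l)
      (populationGain γp γm (population γp γm x n t) l
        - lossRate γp γm l * population γp γm x (n + 1) t l) t :=
  hasDerivAt_duhamel (continuous_populationGain x n l) _ _ t

theorem population_succ_zero (x : ℕ → ℝ) (n l : ℕ) : population γp γm x (n + 1) 0 l = x l :=
  duhamel_zero_right _ _ _

theorem populationGain_mono (hγp : 0 ≤ γp) (hγm : 0 ≤ γm) : Monotone (populationGain γp γm) := by
  intro y z h l
  unfold populationGain
  gcongr
  exacts [h _, h _]

theorem population_mono_left (hγp : 0 ≤ γp) (hγm : 0 ≤ γm) (hxy : x ≤ y) (n : ℕ) (ht : 0 ≤ t) :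
    population γp γm x n t ≤ population γp γm y n t := by
  induction n generalizing t with
  | zero => exact le_rfl
  | succ n ih =>
    exact fun l => duhamel_mono (continuous_populationGain x n l).continuousOn
      (continuous_populationGain y n l).continuousOn ht (hxy l)
      fun s hs => populationGain_mono hγp hγm (ih hs) l

theorem population_le_succ (hγp : 0 ≤ γp) (hγm : 0 ≤ γm) (hx : 0 ≤ x) (n : ℕ) (ht : 0 ≤ t) :
    population γp γm x n t ≤ population γp γm x (n + 1) t := by
  induction n generalizing t with
  | zero =>
    intro l
    calc (0 : ℝ) = duhamel (lossRate γp γm l) 0 0 t := by simp [duhamel]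
      _ ≤ population γp γm x 1 t l := duhamel_mono continuousOn_const
        (continuous_populationGain x 0 l).continuousOn ht (hx l)
        fun s _ => by simp [populationGain, population]
  | succ n ih =>
    exact fun l => duhamel_mono (continuous_populationGain x n l).continuousOn
      (continuous_populationGain x (n + 1) l).continuousOn ht le_rfl
      fun s hs => populationGain_mono hγp hγm (ih hs) l

theorem population_mono (hγp : 0 ≤ γp) (hγm : 0 ≤ γm) (hx : 0 ≤ x) (ht : 0 ≤ t) :
    Monotone fun n => population γp γm x n t :=
  monotone_nat_of_le_succ fun n => population_le_succ hγp hγm hx n ht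

theorem population_nonneg (hγp : 0 ≤ γp) (hγm : 0 ≤ γm) (hx : 0 ≤ x) (n : ℕ) (ht : 0 ≤ t) :
    0 ≤ population γp γm x n t :=
  population_mono hγp hγm hx ht n.zero_le

theorem population_eq_zero {M : ℕ} (hx : ∀ l, M ≤ l → x l = 0) (n : ℕ) (t : ℝ) {l : ℕ}
    (hl : M + n ≤ l) : population γp γm x n t l = 0 := by
  induction n generalizing t l with
  | zero => rfl
  | succ n ih =>
    have h : ∀ s, populationGain γp γm (population γp γm x n s) l = 0 := fun s => by
      rw [populationGain, ih s (by omega), ih s (by omega)]; ring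
    simp [population, duhamel, hx l (by omega), h]

theorem sum_mul_populationGain {c : ℕ → ℝ} {L : ℕ} (hc : ∀ l, L ≤ l + 1 → c l = 0) (w : ℕ → ℝ) :
    ∑ l ∈ Finset.range L, w l * populationGain γp γm c l
      = ∑ l ∈ Finset.range L, (γp * (l + 1) * w (l + 1) + γm * l * w (l - 1)) * c l := by
  rcases L with _ | L
  · simp
  have hup : ∑ l ∈ Finset.range (L + 1), w l * (γp * l * c (l - 1))
      = ∑ l ∈ Finset.range (L + 1), γp * (l + 1) * w (l + 1) * c l := by
    rw [Finset.sum_range_succ', Finset.sum_range_succ (fun l : ℕ => γp * (l + 1) * w (l + 1) * c l),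
      hc L le_rfl]
    simp only [Nat.cast_zero, mul_zero, zero_mul, add_zero]
    refine Finset.sum_congr rfl fun l _ => ?_
    push_cast
    ring
  have hdown : ∑ l ∈ Finset.range (L + 1), w l * (γm * (l + 1) * c (l + 1))
      = ∑ l ∈ Finset.range (L + 1), γm * l * w (l - 1) * c l := by
    rw [Finset.sum_range_succ, Finset.sum_range_succ' (fun l : ℕ => γm * l * w (l - 1) * c l),
      hc (L + 1) (by omega)]
    simp only [Nat.cast_zero, mul_zero, zero_mul, add_zero]
    refine Finset.sum_congr rfl fun l _ => ?_
    push_cast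
    ring
  simp only [populationGain, mul_add (w _), add_mul _ _ (c _), Finset.sum_add_distrib, hup, hdown]

theorem energy_rate_le (hγp : 0 ≤ γp) (hγm : 0 ≤ γm) {c c' : ℕ → ℝ} {L : ℕ}
    (hc : ∀ l, L ≤ l + 1 → c l = 0) (hcc' : c ≤ c') (hc' : 0 ≤ c') :
    ∑ l ∈ Finset.range L, ((l : ℝ) + 1) * (populationGain γp γm c l - lossRate γp γm l * c' l)
      ≤ γp * ∑ l ∈ Finset.range L, ((l : ℝ) + 1) * c' l := by
  simp only [mul_sub, Finset.sum_sub_distrib]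
  rw [sum_mul_populationGain hc fun l => (l : ℝ) + 1, ← Finset.sum_sub_distrib, Finset.mul_sum]
  refine Finset.sum_le_sum fun l _ => ?_
  have hpred : (l : ℝ) * (((l - 1 : ℕ) : ℝ) + 1) = l * l := by
    rcases l with _ | l
    · simp
    · push_cast [Nat.add_sub_cancel]; ring
  have hcoeff : γp * (l + 1) * (((l + 1 : ℕ) : ℝ) + 1) + γm * l * (((l - 1 : ℕ) : ℝ) + 1)
      = γp * (l + 1) * (l + 2) + γm * (l * l) := by
    push_cast
    linear_combination γm * hpred
  have hmono : (γp * (l + 1) * (l + 2) + γm * (l * l)) * c l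
      ≤ (γp * (l + 1) * (l + 2) + γm * (l * l)) * c' l :=
    mul_le_mul_of_nonneg_left (hcc' l) (by positivity)
  have hdeath : 0 ≤ γm * l * c' l := mul_nonneg (by positivity) (hc' l)
  rw [hcoeff]
  simp only [lossRate]
  nlinarith

theorem population_energy_le (hγp : 0 ≤ γp) (hγm : 0 ≤ γm) (hx : 0 ≤ x) {M : ℕ}
    (hM : ∀ l, M ≤ l → x l = 0) (n : ℕ) {L : ℕ} (hL : M + n + 1 ≤ L) (ht : 0 ≤ t) :
    ∑ l ∈ Finset.range L, ((l : ℝ) + 1) * population γp γm x n t l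
      ≤ Real.exp (γp * t) * ∑ l ∈ Finset.range L, ((l : ℝ) + 1) * x l := by
  refine le_trans (Finset.sum_le_sum fun l _ => mul_le_mul_of_nonneg_left
    (population_le_succ hγp hγm hx n ht l) (by positivity)) ?_
  have hderiv : ∀ s, HasDerivAt
      (fun s => ∑ l ∈ Finset.range L, ((l : ℝ) + 1) * population γp γm x (n + 1) s l)
      (∑ l ∈ Finset.range L, ((l : ℝ) + 1) * (populationGain γp γm (population γp γm x n s) l
        - lossRate γp γm l * population γp γm x (n + 1) s l)) s := fun s =>
    HasDerivAt.fun_sum fun l _ => (hasDerivAt_population_succ x n s l).const_mul _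
  have hgronwall := le_gronwallBound_of_liminf_deriv_right_le (a := 0) (b := t) (K := γp) (ε := 0)
    (fun s _ => (hderiv s).continuousAt.continuousWithinAt)
    (fun s _ _ => (hderiv s).hasDerivWithinAt.liminf_right_slope_le) le_rfl
    (fun s hs => by
      rw [add_zero]
      exact energy_rate_le hγp hγm (fun l hl => population_eq_zero hM n s (by omega))
        (population_le_succ hγp hγm hx n hs.1) (population_nonneg hγp hγm hx (n + 1) hs.1))
    t ⟨ht, le_rfl⟩
  simpa only [gronwallBound_ε0, sub_zero, population_succ_zero, mul_comm] using hgronwall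

theorem sum_lossRate_mul_population_le (hγp : 0 ≤ γp) (hγm : 0 ≤ γm) (hx : 0 ≤ x) {M : ℕ}
    (hM : ∀ l, M ≤ l → x l = 0) (n : ℕ) {L : ℕ} (hL : M + n + 1 ≤ L) (ht : 0 ≤ t) :
    ∑ l ∈ Finset.range L, lossRate γp γm l * population γp γm x n t l
      ≤ (γp + γm) * (Real.exp (γp * t) * ∑ l ∈ Finset.range L, ((l : ℝ) + 1) * x l) := by
  refine le_trans ?_ (mul_le_mul_of_nonneg_left (population_energy_le hγp hγm hx hM n hL ht)
    (add_nonneg hγp hγm))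
  rw [Finset.mul_sum]
  refine Finset.sum_le_sum fun l _ => ?_
  rw [← mul_assoc]
  refine mul_le_mul_of_nonneg_right ?_ (population_nonneg hγp hγm hx n ht l)
  simp only [lossRate]
  nlinarith

theorem hasDerivAt_sum_population {M : ℕ} (hM : ∀ l, M ≤ l → x l = 0) (N : ℕ) {L : ℕ}
    (hL : M + N + 1 ≤ L) (t : ℝ) :
    HasDerivAt (fun s => ∑ n ∈ Finset.range N, ∑ l ∈ Finset.range L,
        population γp γm x (n + 1) s l)
      (-∑ l ∈ Finset.range L, lossRate γp γm l * population γp γm x N t l) t := by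
  have hflow : ∀ n ∈ Finset.range N, ∑ l ∈ Finset.range L,
        (populationGain γp γm (population γp γm x n t) l
          - lossRate γp γm l * population γp γm x (n + 1) t l)
      = ∑ l ∈ Finset.range L, lossRate γp γm l * population γp γm x n t l
        - ∑ l ∈ Finset.range L, lossRate γp γm l * population γp γm x (n + 1) t l := by
    intro n hn
    have hn := Finset.mem_range.mp hn
    have hgain := sum_mul_populationGain (γp := γp) (γm := γm) (c := population γp γm x n t)
      (L := L) (fun l hl => population_eq_zero hM n t (by omega)) 1
    simp only [Pi.one_apply, one_mul, mul_one] at hgain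
    rw [Finset.sum_sub_distrib, hgain]
    rfl
  refine (HasDerivAt.fun_sum fun n _ => HasDerivAt.fun_sum fun l _ =>
    hasDerivAt_population_succ x n t l).congr_deriv ?_
  rw [Finset.sum_congr rfl hflow, Finset.sum_range_sub' (fun n => ∑ l ∈ Finset.range L,
    lossRate γp γm l * population γp γm x n t l) N]
  simp [population]

theorem population_mass_deficit_le (hγp : 0 ≤ γp) (hγm : 0 ≤ γm) (hx : 0 ≤ x) {M : ℕ}
    (hM : ∀ l, M ≤ l → x l = 0) (N : ℕ) {L : ℕ} (hL : M + N + 1 ≤ L) (ht : 0 ≤ t) :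
    N * (∑ l ∈ Finset.range L, x l - ∑ l ∈ Finset.range L, population γp γm x N t l)
      ≤ (γp + γm) * (Real.exp (γp * t) * ∑ l ∈ Finset.range L, ((l : ℝ) + 1) * x l) * t := by
  set bound := (γp + γm) * (Real.exp (γp * t) * ∑ l ∈ Finset.range L, ((l : ℝ) + 1) * x l)
  have hderiv := hasDerivAt_sum_population (γp := γp) (γm := γm) hM N hL
  have hmean := (convex_Icc 0 t).mul_sub_le_image_sub_of_le_deriv (C := -bound)
    (fun s _ => (hderiv s).continuousAt.continuousWithinAt)
    (fun s _ => (hderiv s).differentiableAt.differentiableWithinAt)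
    (fun s hs => by
      rw [interior_Icc] at hs
      rw [(hderiv s).deriv, neg_le_neg_iff]
      refine (sum_lossRate_mul_population_le hγp hγm hx hM N hL hs.1.le).trans ?_
      have henergy : 0 ≤ ∑ l ∈ Finset.range L, ((l : ℝ) + 1) * x l :=
        Finset.sum_nonneg fun l _ => mul_nonneg (by positivity) (hx l)
      change _ ≤ (γp + γm) * (Real.exp (γp * t) * _)
      gcongr
      exact hs.2.le)
    0 (Set.left_mem_Icc.mpr ht) t (Set.right_mem_Icc.mpr ht) ht
  have hlast : ∑ n ∈ Finset.range N, ∑ l ∈ Finset.range L, population γp γm x (n + 1) t l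
      ≤ N * ∑ l ∈ Finset.range L, population γp γm x N t l := by
    refine (Finset.sum_le_card_nsmul _ _ _ fun n hn => Finset.sum_le_sum fun l _ =>
      population_mono hγp hγm hx ht (Finset.mem_range.mp hn) l).trans_eq ?_
    simp
  simp only [population_succ_zero, Finset.sum_const, Finset.card_range, nsmul_eq_mul] at hmean
  linarith

theorem eventually_population_mass_of_support (hγp : 0 ≤ γp) (hγm : 0 ≤ γm) (hx : 0 ≤ x) {M : ℕ}
    (hM : ∀ l, M ≤ l → x l = 0) (ht : 0 ≤ t) {ε : ℝ} (hε : 0 < ε) :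
    ∀ᶠ n in atTop, ∑ l ∈ Finset.range M, x l - ε
      ≤ ∑ l ∈ Finset.range (M + n + 1), population γp γm x n t l := by
  have hsum : ∀ (w : ℕ → ℝ) (n : ℕ), ∑ l ∈ Finset.range (M + n + 1), w l * x l
      = ∑ l ∈ Finset.range M, w l * x l := fun w n =>
    (Finset.sum_subset (Finset.range_subset_range.mpr (by omega)) fun l _ hl => by
      rw [hM l (by simpa using hl), mul_zero]).symm
  set bound := (γp + γm) * (Real.exp (γp * t) * ∑ l ∈ Finset.range M, ((l : ℝ) + 1) * x l) * t
  filter_upwards [eventually_gt_atTop 0, (tendsto_natCast_atTop_atTop (R := ℝ)).eventually_ge_atTop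
    (bound / ε)] with n hn hbound
  have hn : (0 : ℝ) < n := Nat.cast_pos.mpr hn
  have hdeficit := population_mass_deficit_le hγp hγm hx hM n le_rfl ht
  have hmass := hsum 1 n
  simp only [Pi.one_apply, one_mul] at hmass
  rw [hsum (fun l => (l : ℝ) + 1), hmass] at hdeficit
  have := le_of_mul_le_mul_left (hdeficit.trans ((div_le_iff₀ hε).mp hbound)) hn
  linarith

theorem eventually_population_mass (hγp : 0 ≤ γp) (hγm : 0 ≤ γm) (hx : 0 ≤ x) {m : ℝ}
    (hs : HasSum x m) (ht : 0 ≤ t) {ε : ℝ} (hε : 0 < ε) :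
    ∀ᶠ N in atTop, m - ε ≤ ∑ l ∈ Finset.range N, population γp γm x N t l := by
  obtain ⟨M, hM⟩ := (hs.tendsto_sum_nat.eventually
    (lt_mem_nhds (show m - ε / 2 < m by linarith))).exists
  set y : ℕ → ℝ := fun l => if l < M then x l else 0 with hy
  have hy0 : 0 ≤ y := fun l => by simp only [hy]; split_ifs; exacts [hx l, le_rfl]
  have hyx : y ≤ x := fun l => by simp only [hy]; split_ifs; exacts [le_rfl, hx l]
  have hyM : ∀ l, M ≤ l → y l = 0 := fun l hl => if_neg (not_lt.mpr hl)
  have hysum : ∑ l ∈ Finset.range M, y l = ∑ l ∈ Finset.range M, x l :=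
    Finset.sum_congr rfl fun l hl => if_pos (Finset.mem_range.mp hl)
  obtain ⟨n, hn⟩ := (eventually_population_mass_of_support hγp hγm hy0 hyM ht (half_pos hε)).exists
  filter_upwards [eventually_ge_atTop (M + n + 1)] with N hN
  calc m - ε ≤ ∑ l ∈ Finset.range (M + n + 1), population γp γm y n t l := by linarith
    _ ≤ ∑ l ∈ Finset.range (M + n + 1), population γp γm x N t l := Finset.sum_le_sum fun l _ =>
        (population_mono_left hγp hγm hyx n ht l).trans
          (population_mono hγp hγm hx ht (by omega : n ≤ N) l)
    _ ≤ _ := Finset.sum_le_sum_of_subset_of_nonneg (Finset.range_subset_range.mpr hN)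
        fun l _ _ => population_nonneg hγp hγm hx N ht l

end Population

section FockMatrix

open scoped ComplexOrder
open Matrix

variable {H : Type*} [NormedAddCommGroup H] [InnerProductSpace ℂ H] {fock : HilbertBasis ℕ ℂ H}
  {γp γm : ℝ} {r : ℝ → H →L[ℂ] H} {ρ : H →L[ℂ] H}

/-- The matrix of an operator in the Fock basis, as a real-linear map: states are combined with
real weights. -/
def fockMatrix (fock : HilbertBasis ℕ ℂ H) : (H →L[ℂ] H) →ₗ[ℝ] Matrix ℕ ℕ ℂ where
  toFun ρ := Matrix.of fun j k => ⟪fock j, ρ (fock k)⟫_ℂ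
  map_add' ρ σ := by ext j k; simp
  map_smul' c ρ := by ext j k; simp [inner_smul_right_eq_smul]

theorem fockMatrix_apply (ρ : H →L[ℂ] H) (j k : ℕ) :
    fockMatrix fock ρ j k = ⟪fock j, ρ (fock k)⟫_ℂ := rfl

theorem fockMatrix_one : fockMatrix fock 1 = 1 := by
  ext j k
  simp [fockMatrix_apply, one_apply, orthonormal_iff_ite.mp fock.orthonormal]

theorem fockMatrix_posSemidef (hρ : ρ.IsPositive) : (fockMatrix fock ρ).PosSemidef := by
  refine ⟨Matrix.ext fun j k => ?_, fun v => ?_⟩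
  · rw [conjTranspose_apply, fockMatrix_apply, fockMatrix_apply, RCLike.star_def, inner_conj_symm]
    exact hρ.isSymmetric _ _
  · convert hρ.inner_nonneg_right (v.sum fun k vk => vk • fock k) using 1
    simp only [Finsupp.sum, fockMatrix_apply, map_sum, map_smul, sum_inner, inner_sum,
      inner_smul_left, inner_smul_right, RCLike.star_def, Finset.mul_sum]
    rw [Finset.sum_comm]
    exact Finset.sum_congr rfl fun j _ => Finset.sum_congr rfl fun k _ => by ring

theorem annihilate_single (m : ℕ) (z : ℂ) :
    annihilate (Finsupp.single m z) = Finsupp.single (m - 1) (z * (√m : ℝ)) := by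
  simp [annihilate]

theorem create_single (m : ℕ) (z : ℂ) :
    create (Finsupp.single m z) = Finsupp.single (m + 1) (z * (√(m + 1) : ℝ)) := by
  simp [create]

theorem annihilate_create_single (m : ℕ) :
    annihilate (create (Finsupp.single m 1)) = Finsupp.single m ((m : ℂ) + 1) := by
  rw [create_single, annihilate_single, Nat.add_sub_cancel, one_mul, Nat.cast_add_one,
    ← Complex.ofReal_mul, Real.mul_self_sqrt (by positivity)]
  simp

theorem create_annihilate_single (m : ℕ) :
    create (annihilate (Finsupp.single m 1)) = Finsupp.single m (m : ℂ) := by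
  rcases m with _ | m
  · simp [annihilate_single]
  · rw [annihilate_single, create_single, Nat.add_sub_cancel, one_mul, Nat.cast_add_one,
      ← Complex.ofReal_mul, Real.mul_self_sqrt (by positivity)]
    simp

theorem matrixElement_single (ρ : H →L[ℂ] H) (j k : ℕ) (a b : ℂ) :
    matrixElement fock ρ (Finsupp.single j a) (Finsupp.single k b)
      = star a * b * fockMatrix fock ρ j k := by
  simp only [matrixElement, Finsupp.linearCombination_single, map_smul, inner_smul_left,
    inner_smul_right, fockMatrix_apply, RCLike.star_def]
  ring

theorem lindblad_single (ρ : H →L[ℂ] H) (m n : ℕ) :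
    lindblad fock γp γm ρ (Finsupp.single m 1) (Finsupp.single n 1)
      = gain γp γm (fockMatrix fock ρ) m n
        - decayRate γp γm m n • fockMatrix fock ρ m n := by
  simp only [lindblad, lindbladPlus, lindbladMinus, annihilate_create_single,
    create_annihilate_single]
  simp only [annihilate_single, create_single, matrixElement_single, gain, decayRate, lossRate,
    of_apply, star_add, star_one, RCLike.star_def, Complex.conj_ofReal, Complex.conj_natCast,
    one_mul, Complex.real_smul]
  push_cast
  ring

theorem isOrbit_iff : IsOrbit fock γp γm r ↔ (∀ t, 0 ≤ t → IsDensity fock (r t)) ∧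
    IsMasterSolution γp γm fun t => fockMatrix fock (r t) := by
  simp [IsOrbit, IsMasterSolution, lindblad_single, matrixElement_single]

theorem IsDensity.re_fockMatrix_diag_nonneg (h : IsDensity fock ρ) (l : ℕ) :
    0 ≤ (fockMatrix fock ρ l l).re :=
  (Complex.nonneg_iff.mp (h.1.inner_nonneg_right (fock l))).1

theorem IsDensity.sum_re_fockMatrix_diag_le_one (h : IsDensity fock ρ) (N : ℕ) :
    ∑ l ∈ Finset.range N, (fockMatrix fock ρ l l).re ≤ 1 :=
  sum_le_hasSum _ (fun l _ => h.re_fockMatrix_diag_nonneg l) (Complex.hasSum_re h.2)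

end FockMatrix

section TruncatedForm

open scoped ComplexOrder
open Matrix

variable {H : Type*} [NormedAddCommGroup H] [InnerProductSpace ℂ H] {fock : HilbertBasis ℕ ℂ H}

/-- The quadratic form at `x` of the operator with matrix `X` in the Fock basis, cut off at
level `N`. -/
def truncatedForm (fock : HilbertBasis ℕ ℂ H) (N : ℕ) (x : H) : Matrix ℕ ℕ ℂ →ₗ[ℝ] ℝ where
  toFun X := (∑ j ∈ Finset.range N, ∑ k ∈ Finset.range N,
    ⟪x, fock j⟫_ℂ * X j k * ⟪fock k, x⟫_ℂ).re
  map_add' X Y := by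
    simp only [Matrix.add_apply, mul_add, add_mul, Finset.sum_add_distrib, Complex.add_re]
  map_smul' c X := by
    simp only [Matrix.smul_apply, mul_smul_comm, smul_mul_assoc, ← Finset.smul_sum,
      Complex.smul_re, RingHom.id_apply]

theorem truncatedForm_apply (N : ℕ) (x : H) (X : Matrix ℕ ℕ ℂ) :
    truncatedForm fock N x X = (∑ j ∈ Finset.range N, ∑ k ∈ Finset.range N,
      ⟪x, fock j⟫_ℂ * X j k * ⟪fock k, x⟫_ℂ).re := rfl

theorem truncatedForm_one_le (N : ℕ) (x : H) : truncatedForm fock N x 1 ≤ ‖x‖ ^ 2 := by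
  refine le_trans (le_of_eq ?_)
    (fock.orthonormal.sum_inner_products_le x (s := Finset.range N))
  rw [truncatedForm_apply, Complex.re_sum]
  refine Finset.sum_congr rfl fun j hj => ?_
  simp only [one_apply, mul_ite, mul_one, mul_zero, ite_mul, zero_mul, Finset.sum_ite_eq, hj,
    if_true]
  rw [← inner_conj_symm x, Complex.conj_mul']
  norm_cast

theorem tendsto_truncatedForm_fockMatrix (ρ : H →L[ℂ] H) (x : H) :
    Tendsto (fun N => truncatedForm fock N x (fockMatrix fock ρ)) atTop (𝓝 (⟪x, ρ x⟫_ℂ).re) := by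
  have hx : Tendsto (fun N => ∑ k ∈ Finset.range N, ⟪fock k, x⟫_ℂ • fock k) atTop (𝓝 x) := by
    simpa only [HilbertBasis.repr_apply_apply] using (fock.hasSum_repr x).tendsto_sum_nat
  refine ((Complex.continuous_re.tendsto _).comp
    (hx.inner ((ρ.continuous.tendsto x).comp hx))).congr fun N => ?_
  simp only [Function.comp_apply, truncatedForm_apply, fockMatrix_apply, map_sum, map_smul,
    sum_inner, inner_sum, inner_smul_left, inner_smul_right, inner_conj_symm,
    Finset.mul_sum]
  rw [Finset.sum_comm]
  congr 1
  exact Finset.sum_congr rfl fun j _ => Finset.sum_congr rfl fun k _ => by ring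

theorem exists_truncatedForm_eq_sum_norm_inner_sq {X : Matrix ℕ ℕ ℂ} (hX : X.PosSemidef)
    (fock : HilbertBasis ℕ ℂ H) (N : ℕ) :
    ∃ (m : ℕ) (v : Fin m → H),
      (∀ x, truncatedForm fock N x X = ∑ a, ‖⟪v a, x⟫_ℂ‖ ^ 2) ∧
      ∑ a, ‖v a‖ ^ 2 = ∑ l ∈ Finset.range N, (X l l).re := by
  obtain ⟨m, w, hw⟩ := posSemidef_iff_eq_sum_vecMulVec.mp
    (hX.submatrix (Fin.val : Fin N → ℕ))
  have hXw : ∀ j k : Fin N, X j k = ∑ a, w a j * star (w a k) := fun j k => by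
    simpa [Matrix.sum_apply, vecMulVec_apply] using congr_fun₂ hw j k
  have horth : Orthonormal ℂ fun j : Fin N => fock j :=
    fock.orthonormal.comp _ Fin.val_injective
  refine ⟨m, fun a => ∑ j : Fin N, w a j • fock j, fun x => ?_, ?_⟩
  · have hnorm : ∀ a, (‖⟪∑ j : Fin N, w a j • fock j, x⟫_ℂ‖ ^ 2 : ℂ)
        = ∑ j : Fin N, ∑ k : Fin N, ⟪x, fock j⟫_ℂ * (w a j * star (w a k)) * ⟪fock k, x⟫_ℂ := by
      intro a
      rw [← Complex.conj_mul', inner_conj_symm, inner_sum, sum_inner, Finset.sum_mul_sum]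
      simp only [inner_smul_left, inner_smul_right, RCLike.star_def]
      exact Finset.sum_congr rfl fun j _ => Finset.sum_congr rfl fun k _ => by ring
    rw [truncatedForm_apply, ← Complex.ofReal_re (∑ a, _)]
    push_cast
    simp only [hnorm, Finset.sum_range, hXw, Finset.mul_sum, Finset.sum_mul]
    congr 1
    rw [Finset.sum_comm (s := (Finset.univ : Finset (Fin m)))]
    exact Finset.sum_congr rfl fun j _ => Finset.sum_comm
  · have hnorm : ∀ a, (‖∑ j : Fin N, w a j • fock j‖ ^ 2 : ℝ) = ∑ j, ‖w a j‖ ^ 2 := by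
      intro a
      rw [← inner_self_eq_norm_sq (𝕜 := ℂ), horth.inner_sum, map_sum]
      simp only [Complex.conj_mul', RCLike.re_to_complex, ← Complex.ofReal_pow, Complex.ofReal_re]
    simp only [hnorm, Finset.sum_range, hXw, Complex.re_sum, RCLike.star_def, Complex.mul_conj',
      ← Complex.ofReal_pow, Complex.ofReal_re]
    exact Finset.sum_comm

theorem truncatedForm_nonneg {X : Matrix ℕ ℕ ℂ} (hX : X.PosSemidef) (N : ℕ) (x : H) :
    0 ≤ truncatedForm fock N x X := by
  obtain ⟨m, v, hv, -⟩ := exists_truncatedForm_eq_sum_norm_inner_sq hX fock N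
  rw [hv]
  positivity

theorem sum_truncatedForm_le_trace {X : Matrix ℕ ℕ ℂ} (hX : X.PosSemidef) {ι : Type*} {e : ι → H}
    (he : Orthonormal ℂ e) (N : ℕ) (G : Finset ι) :
    ∑ i ∈ G, truncatedForm fock N (e i) X ≤ ∑ l ∈ Finset.range N, (X l l).re := by
  obtain ⟨m, v, hv, htrace⟩ := exists_truncatedForm_eq_sum_norm_inner_sq hX fock N
  simp only [hv, ← htrace]
  rw [Finset.sum_comm]
  refine Finset.sum_le_sum fun a _ => le_trans (le_of_eq ?_)
    (he.sum_inner_products_le (v a) (s := G))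
  simp only [norm_inner_symm]

end TruncatedForm

section DysonTransition

open InnerProductSpace
open scoped ComplexOrder

variable {H : Type*} [NormedAddCommGroup H] [InnerProductSpace ℂ H] {fock : HilbertBasis ℕ ℂ H}
  {γp γm : ℝ} {r : ℝ → H →L[ℂ] H} {t : ℝ} {ι κ : Type*}

theorem isPositive_sub_sum_smul_rankOne {ρ : H →L[ℂ] H} (hρ : ρ.IsSymmetric) {f : κ → H}
    {p : κ → ℝ} {F : Finset κ}
    (h : ∀ x, ∑ j ∈ F, p j * ‖⟪f j, x⟫_ℂ‖ ^ 2 ≤ (⟪x, ρ x⟫_ℂ).re) :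
    (ρ - ∑ j ∈ F, p j • rankOne ℂ (f j) (f j)).IsPositive := by
  refine ⟨fun x y => ?_, fun x => ?_⟩
  · have hρxy : ⟪ρ x, y⟫_ℂ = ⟪x, ρ y⟫_ℂ := hρ x y
    simp [inner_sub_left, inner_sub_right, hρxy, sum_inner, inner_sum, mul_comm]
  · have hρx : ⟪ρ x, x⟫_ℂ = ⟪x, ρ x⟫_ℂ := hρ x x
    have hnorm : ∀ j, ⟪x, f j⟫_ℂ * ⟪f j, x⟫_ℂ = (‖⟪f j, x⟫_ℂ‖ ^ 2 : ℝ) := fun j => by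
      rw [← inner_conj_symm x, Complex.conj_mul', Complex.ofReal_pow]
    simpa [ContinuousLinearMap.reApplyInnerSelf_apply, inner_sub_left, sum_inner, hρx, hnorm,
      mul_comm ⟪f _, x⟫_ℂ, ← Complex.ofReal_pow] using h x

theorem isPositive_one_sub_sum_rankOne {f : κ → H} (hf : Orthonormal ℂ f) (F : Finset κ) :
    (1 - ∑ j ∈ F, rankOne ℂ (f j) (f j)).IsPositive := by
  have h := isPositive_sub_sum_smul_rankOne (ρ := 1) (f := f) (p := 1) (F := F)
    (fun _ _ => rfl) fun x => by
      simpa [inner_self_eq_norm_sq_to_K, ← Complex.ofReal_pow] using hf.sum_inner_products_le x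
  simpa only [Pi.one_apply, one_smul] using h

theorem isPositive_sub_sum_eigenvalue_smul_rankOne [CompleteSpace H] {ρ : H →L[ℂ] H}
    (hρ : IsSelfAdjoint ρ) (f : HilbertBasis κ ℂ H) {p : κ → ℝ}
    (hf : ∀ j, ρ (f j) = (p j : ℂ) • f j) (hp : ∀ j, 0 ≤ p j) (F : Finset κ) :
    (ρ - ∑ j ∈ F, p j • rankOne ℂ (f j) (f j)).IsPositive :=
  isPositive_sub_sum_smul_rankOne hρ.isSymmetric fun x =>
    sum_le_hasSum F (fun j _ => mul_nonneg (hp j) (by positivity))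
      (hasSum_eigenvalue_mul_norm_inner_sq hρ f hf x)

/-- The probability of finding the state `y` in the state `x` at time `t`, approximated by the
`N`-th partial sum of the Dyson series cut off at level `N`. -/
def dysonTransition (fock : HilbertBasis ℕ ℂ H) (γp γm t : ℝ) (N : ℕ) (x y : H) : ℝ :=
  truncatedForm fock N x (dyson γp γm (fockMatrix fock (rankOne ℂ y y)) N t)

theorem dysonTransition_nonneg (hγp : 0 ≤ γp) (hγm : 0 ≤ γm) (ht : 0 ≤ t) (N : ℕ) (x y : H) :
    0 ≤ dysonTransition fock γp γm t N x y :=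
  truncatedForm_nonneg (dyson_posSemidef hγp hγm
    (fockMatrix_posSemidef (isPositive_rankOne_self y)) N ht) N x

theorem sum_mul_dysonTransition (ht : 0 ≤ t) (N : ℕ) (x : H) (f : κ → H) (p : κ → ℝ)
    (F : Finset κ) :
    ∑ j ∈ F, p j * dysonTransition fock γp γm t N x (f j)
      = truncatedForm fock N x
        (dyson γp γm (fockMatrix fock (∑ j ∈ F, p j • rankOne ℂ (f j) (f j))) N t) := by
  have hdyson := map_sum ((isLinearMap_dyson (γp := γp) (γm := γm) N ht).mk' _)
    (fun j => p j • fockMatrix fock (rankOne ℂ (f j) (f j))) F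
  simp only [map_smul, IsLinearMap.mk'_apply] at hdyson
  simp only [dysonTransition, map_sum, map_smul, hdyson, smul_eq_mul]

theorem sum_dysonTransition_le (hγp : 0 ≤ γp) (hγm : 0 ≤ γm) (ht : 0 ≤ t) {f : κ → H}
    (hf : Orthonormal ℂ f) (N : ℕ) (x : H) (F : Finset κ) :
    ∑ j ∈ F, dysonTransition fock γp γm t N x (f j) ≤ Real.exp ((γm - γp) * t) * ‖x‖ ^ 2 := by
  have hpos := truncatedForm_nonneg (fock := fock) (exp_smul_one_sub_dyson_posSemidef hγp hγm
    (by simpa only [map_sub, fockMatrix_one] using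
      fockMatrix_posSemidef (fock := fock) (isPositive_one_sub_sum_rankOne hf F)) N ht) N x
  have hsum := sum_mul_dysonTransition (fock := fock) (γp := γp) (γm := γm) ht N x f 1 F
  simp only [Pi.one_apply, one_mul, one_smul] at hsum
  rw [map_sub, map_smul, ← hsum, sub_nonneg] at hpos
  exact hpos.trans (mul_le_mul_of_nonneg_left (truncatedForm_one_le N x) (Real.exp_nonneg _))

section Eigenbasis

variable [CompleteSpace H] {f : HilbertBasis κ ℂ H} {p : κ → ℝ}

theorem IsOrbit.fockMatrix_sub_dyson_posSemidef (hγp : 0 ≤ γp) (hγm : 0 ≤ γm)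
    (hr : IsOrbit fock γp γm r) (ht : 0 ≤ t) (hf : ∀ j, r 0 (f j) = (p j : ℂ) • f j)
    (F : Finset κ) (N : ℕ) :
    (fockMatrix fock (r t) - dyson γp γm
      (fockMatrix fock (∑ j ∈ F, p j • rankOne ℂ (f j) (f j))) N t).PosSemidef := by
  have h0 := hr.1 0 le_rfl
  refine (isOrbit_iff.mp hr).2.sub_dyson_posSemidef hγp hγm
    (fun s hs => fockMatrix_posSemidef (hr.1 s hs).1) ?_ N ht
  rw [← map_sub]
  exact fockMatrix_posSemidef (isPositive_sub_sum_eigenvalue_smul_rankOne h0.1.isSelfAdjoint f hf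
    (h0.eigenvalue_nonneg hf) F)

theorem IsOrbit.sum_mul_dysonTransition_le (hγp : 0 ≤ γp) (hγm : 0 ≤ γm)
    (hr : IsOrbit fock γp γm r) (ht : 0 ≤ t) (hf : ∀ j, r 0 (f j) = (p j : ℂ) • f j)
    (F : Finset κ) (N : ℕ) (x : H) :
    ∑ j ∈ F, p j * dysonTransition fock γp γm t N x (f j)
      ≤ truncatedForm fock N x (fockMatrix fock (r t)) := by
  have hpos := truncatedForm_nonneg (fock := fock)
    (hr.fockMatrix_sub_dyson_posSemidef hγp hγm ht hf F N) N x
  rwa [map_sub, ← sum_mul_dysonTransition ht, sub_nonneg] at hpos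

theorem IsOrbit.eventually_sum_truncatedForm_sub_le (hγp : 0 ≤ γp) (hγm : 0 ≤ γm)
    (hr : IsOrbit fock γp γm r) (ht : 0 ≤ t) (hf : ∀ j, r 0 (f j) = (p j : ℂ) • f j)
    {e : ι → H} (he : Orthonormal ℂ e) (G : Finset ι) (F : Finset κ) {ε : ℝ} (hε : 0 < ε) :
    ∀ᶠ N in atTop, ∑ i ∈ G, (truncatedForm fock N (e i) (fockMatrix fock (r t))
      - ∑ j ∈ F, p j * dysonTransition fock γp γm t N (e i) (f j)) ≤ 1 - ∑ j ∈ F, p j + ε := by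
  set X := fockMatrix fock (∑ j ∈ F, p j • rankOne ℂ (f j) (f j)) with hX
  have hp := (hr.1 0 le_rfl).eigenvalue_nonneg hf
  have hdiag : ∀ l, (X l l).re = ∑ j ∈ F, p j * ‖⟪fock l, f j⟫_ℂ‖ ^ 2 := by
    intro l
    simp only [hX, map_sum, map_smul, Matrix.sum_apply, Matrix.smul_apply, Complex.re_sum,
      Complex.smul_re, smul_eq_mul, fockMatrix_apply, rankOne_apply, inner_smul_right]
    refine Finset.sum_congr rfl fun j _ => ?_
    rw [← inner_conj_symm, Complex.conj_mul', ← Complex.ofReal_pow, Complex.ofReal_re]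
  have hsum : HasSum (fun l => (X l l).re) (∑ j ∈ F, p j) := by
    simp only [hdiag]
    refine hasSum_sum fun j _ => ?_
    simpa [f.orthonormal.1 j] using (hasSum_norm_inner_sq fock (f j)).mul_left (p j)
  have hnonneg : ∀ l, 0 ≤ (X l l).re := fun l => by
    rw [hdiag]
    exact Finset.sum_nonneg fun j _ => mul_nonneg (hp j) (by positivity)
  filter_upwards [eventually_population_mass hγp hγm hnonneg hsum ht hε] with N hN
  have htrace := sum_truncatedForm_le_trace (fock := fock)
    (hr.fockMatrix_sub_dyson_posSemidef hγp hγm ht hf F N) he N G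
  simp only [Matrix.sub_apply, Complex.sub_re, Finset.sum_sub_distrib, map_sub, ← hX,
    re_dyson_diag _ _ _ ht] at htrace
  simp only [Finset.sum_sub_distrib, sum_mul_dysonTransition ht, ← hX]
  linarith [(hr.1 t ht).sum_re_fockMatrix_diag_le_one N]

end Eigenbasis

end DysonTransition

section Transition

variable {H : Type*} [NormedAddCommGroup H] [InnerProductSpace ℂ H] {fock : HilbertBasis ℕ ℂ H}
  {γp γm : ℝ} {r : ℝ → H →L[ℂ] H} {t : ℝ} {ι κ : Type*}

/-- The probability of finding the state `y` in the state `x` at time `t`, as a limit of the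
approximations by Dyson sums. The limit is taken along an ultrafilter, where it exists by
boundedness. -/
def transition (fock : HilbertBasis ℕ ℂ H) (γp γm t : ℝ) (x y : H) : ℝ :=
  limUnder (hyperfilter ℕ : Filter ℕ) fun N => dysonTransition fock γp γm t N x y

theorem tendsto_dysonTransition (hγp : 0 ≤ γp) (hγm : 0 ≤ γm) (ht : 0 ≤ t) (x : H) {y : H}
    (hy : ‖y‖ = 1) :
    Tendsto (fun N => dysonTransition fock γp γm t N x y) (hyperfilter ℕ)
      (𝓝 (transition fock γp γm t x y)) := by
  have hle : ∀ N, dysonTransition fock γp γm t N x y ≤ Real.exp ((γm - γp) * t) * ‖x‖ ^ 2 :=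
    fun N => by
      have hunit : Orthonormal ℂ fun _ : Unit => y :=
        ⟨fun _ => hy, fun i j hij => (hij (Subsingleton.elim i j)).elim⟩
      simpa using sum_dysonTransition_le (fock := fock) hγp hγm ht hunit N x Finset.univ
  obtain ⟨a, -, ha⟩ := isCompact_Icc.ultrafilter_le_nhds
    ((hyperfilter ℕ).map fun N => dysonTransition fock γp γm t N x y)
    (tendsto_principal.mpr (Eventually.of_forall fun N =>
      ⟨dysonTransition_nonneg hγp hγm ht N x y, hle N⟩))
  exact tendsto_nhds_limUnder ⟨a, ha⟩

theorem transition_nonneg (hγp : 0 ≤ γp) (hγm : 0 ≤ γm) (ht : 0 ≤ t) (x : H) {y : H}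
    (hy : ‖y‖ = 1) : 0 ≤ transition fock γp γm t x y :=
  ge_of_tendsto' (tendsto_dysonTransition hγp hγm ht x hy) fun N =>
    dysonTransition_nonneg hγp hγm ht N x y

theorem sum_transition_le (hγp : 0 ≤ γp) (hγm : 0 ≤ γm) (ht : 0 ≤ t) {x : H} (hx : ‖x‖ = 1)
    {f : κ → H} (hf : Orthonormal ℂ f) (F : Finset κ) :
    ∑ j ∈ F, transition fock γp γm t x (f j) ≤ Real.exp ((γm - γp) * t) :=
  le_of_tendsto' (tendsto_finsetSum F fun j _ => tendsto_dysonTransition hγp hγm ht x (hf.1 j))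
    fun N => by simpa [hx] using sum_dysonTransition_le (fock := fock) hγp hγm ht hf N x F

theorem tendsto_sum_mul_dysonTransition (hγp : 0 ≤ γp) (hγm : 0 ≤ γm) (ht : 0 ≤ t) (x : H)
    {f : κ → H} (hf : Orthonormal ℂ f) (p : κ → ℝ) (F : Finset κ) :
    Tendsto (fun N => ∑ j ∈ F, p j * dysonTransition fock γp γm t N x (f j)) (hyperfilter ℕ)
      (𝓝 (∑ j ∈ F, p j * transition fock γp γm t x (f j))) :=
  tendsto_finsetSum F fun j _ => (tendsto_dysonTransition hγp hγm ht x (hf.1 j)).const_mul (p j)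

variable [CompleteSpace H] {f : HilbertBasis κ ℂ H} {p : κ → ℝ}

theorem IsOrbit.sum_mul_transition_le (hγp : 0 ≤ γp) (hγm : 0 ≤ γm) (hr : IsOrbit fock γp γm r)
    (ht : 0 ≤ t) (hf : ∀ j, r 0 (f j) = (p j : ℂ) • f j) (x : H) (F : Finset κ) :
    ∑ j ∈ F, p j * transition fock γp γm t x (f j) ≤ (⟪x, r t x⟫_ℂ).re :=
  le_of_tendsto_of_tendsto' (tendsto_sum_mul_dysonTransition hγp hγm ht x f.orthonormal p F)
    ((tendsto_truncatedForm_fockMatrix (r t) x).mono_left Nat.hyperfilter_le_atTop) fun N =>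
      hr.sum_mul_dysonTransition_le hγp hγm ht hf F N x

theorem IsOrbit.sum_inner_sub_transition_le (hγp : 0 ≤ γp) (hγm : 0 ≤ γm)
    (hr : IsOrbit fock γp γm r) (ht : 0 ≤ t) (hf : ∀ j, r 0 (f j) = (p j : ℂ) • f j) {e : ι → H}
    (he : Orthonormal ℂ e) (G : Finset ι) (F : Finset κ) :
    ∑ i ∈ G, ((⟪e i, r t (e i)⟫_ℂ).re - ∑ j ∈ F, p j * transition fock γp γm t (e i) (f j))
      ≤ 1 - ∑ j ∈ F, p j :=
  le_of_forall_pos_le_add fun _ε hε => le_of_tendsto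
    (tendsto_finsetSum G fun i _ =>
      ((tendsto_truncatedForm_fockMatrix (r t) (e i)).mono_left Nat.hyperfilter_le_atTop).sub
        (tendsto_sum_mul_dysonTransition hγp hγm ht (e i) f.orthonormal p F))
    (Nat.hyperfilter_le_atTop
      (hr.eventually_sum_truncatedForm_sub_le hγp hγm ht hf he G F hε))

theorem IsOrbit.hasSum_mul_transition (hγp : 0 ≤ γp) (hγm : 0 ≤ γm) (hr : IsOrbit fock γp γm r)
    (ht : 0 ≤ t) (hf : ∀ j, r 0 (f j) = (p j : ℂ) • f j) {x : H} (hx : ‖x‖ = 1) :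
    HasSum (fun j => p j * transition fock γp γm t x (f j)) (⟪x, r t x⟫_ℂ).re := by
  have h0 := hr.1 0 le_rfl
  have hle := hr.sum_mul_transition_le hγp hγm ht hf x
  have hsum : Summable fun j => p j * transition fock γp γm t x (f j) :=
    summable_of_sum_le (fun j => mul_nonneg (h0.eigenvalue_nonneg hf j)
      (transition_nonneg hγp hγm ht x (f.orthonormal.1 j))) hle
  have hunit : Orthonormal ℂ fun _ : Unit => x :=
    ⟨fun _ => hx, fun i j hij => (hij (Subsingleton.elim i j)).elim⟩
  have hdeficit : (⟪x, r t x⟫_ℂ).re - ∑' j, p j * transition fock γp γm t x (f j) ≤ 1 - 1 :=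
    le_of_tendsto_of_tendsto' (tendsto_const_nhds.sub hsum.hasSum)
      (tendsto_const_nhds.sub (h0.hasSum_eigenvalue hf)) fun F => by
        simpa using hr.sum_inner_sub_transition_le hγp hγm ht hf hunit Finset.univ F
  rw [sub_self, sub_nonpos] at hdeficit
  exact (hdeficit.antisymm (hsum.tsum_le_of_sum_le hle)) ▸ hsum.hasSum

theorem IsOrbit.one_le_tsum_transition (hγp : 0 ≤ γp) (hγm : 0 ≤ γm) (hr : IsOrbit fock γp γm r)
    (ht : 0 ≤ t) (hf : ∀ j, r 0 (f j) = (p j : ℂ) • f j) {e : HilbertBasis ι ℂ H} {q : ι → ℝ}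
    (he : ∀ i, r t (e i) = (q i : ℂ) • e i) {j : κ} (hj : p j ≠ 0) :
    1 ≤ ∑' i, ENNReal.ofReal (transition fock γp γm t (e i) (f j)) := by
  have hpj : 0 < p j := ((hr.1 0 le_rfl).eigenvalue_nonneg hf j).lt_of_ne' hj
  have hpartial : ∀ G : Finset ι, ENNReal.ofReal ((∑ i ∈ G, q i - (1 - p j)) / p j)
      ≤ ∑' i, ENNReal.ofReal (transition fock γp γm t (e i) (f j)) := fun G => by
    have hmass := hr.sum_inner_sub_transition_le hγp hγm ht hf e.orthonormal G {j}
    simp only [he, inner_smul_right, inner_self_eq_norm_sq_to_K, e.orthonormal.1, RCLike.ofReal_one,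
      one_pow, mul_one, Complex.ofReal_re, Finset.sum_singleton, Finset.sum_sub_distrib,
      ← Finset.mul_sum] at hmass
    refine le_trans ?_ (ENNReal.sum_le_tsum G)
    rw [← ENNReal.ofReal_sum_of_nonneg fun i _ =>
      transition_nonneg hγp hγm ht (e i) (f.orthonormal.1 j)]
    refine ENNReal.ofReal_le_ofReal ((div_le_iff₀' hpj).mpr ?_)
    linarith
  have hlim : Tendsto (fun G : Finset ι => ENNReal.ofReal ((∑ i ∈ G, q i - (1 - p j)) / p j)) atTop
      (𝓝 (ENNReal.ofReal ((1 - (1 - p j)) / p j))) :=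
    ENNReal.tendsto_ofReal ((Tendsto.sub_const (hr.1 t ht |>.hasSum_eigenvalue he) _).div_const _)
  rw [sub_sub_cancel, div_self hj, ENNReal.ofReal_one] at hlim
  exact le_of_tendsto' hlim hpartial

end Transition

section EntropyInequality

theorem negMulLog_le_sub {p x : ℝ} (hp : 0 ≤ p) (hx : 0 < x) :
    Real.negMulLog p ≤ -p * Real.log x - p + x := by
  rcases hp.eq_or_lt with rfl | hp
  · simpa using hx.le
  · have hlog := mul_le_mul_of_nonneg_left (Real.log_le_sub_one_of_pos (div_pos hx hp)) hp.le
    rw [Real.log_div hx.ne' hp.ne', mul_sub_one, mul_div_cancel₀ x hp.ne'] at hlog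
    rw [Real.negMulLog]
    linarith

variable {ι κ : Type*} {p : κ → ℝ} {a : ℝ}

theorem tsum_mul_negMulLog_le (hp : ∀ j, 0 ≤ p j) (hnp : ∀ j, 0 ≤ Real.negMulLog (p j)) {w : κ → ℝ}
    (hw : ∀ j, 0 ≤ w j) (hrow : ∀ F : Finset κ, ∑ j ∈ F, w j ≤ Real.exp a) {q : ℝ}
    (hsum : HasSum (fun j => p j * w j) q) :
    ∑' j, ENNReal.ofReal (w j * Real.negMulLog (p j))
      ≤ ENNReal.ofReal (Real.negMulLog q + a * q) := by
  have hq : 0 ≤ q := hsum.nonneg fun j => mul_nonneg (hp j) (hw j)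
  rcases hq.eq_or_lt with rfl | hq
  · have hzero : ∀ j, w j * Real.negMulLog (p j) = 0 := fun j => by
      have hj := congr_fun ((hasSum_zero_iff_of_nonneg fun j => mul_nonneg (hp j) (hw j)).mp hsum) j
      rcases mul_eq_zero.mp hj with h | h <;> simp [h]
    simp [hzero]
  -- Bounding `negMulLog` by its tangent at `q / eᵃ` makes the sum linear in `p j * w j` and `w j`.
  set x := q / Real.exp a with hx
  have hx0 : 0 < x := div_pos hq (Real.exp_pos a)
  have hbound : ∀ F : Finset κ, ∑ j ∈ F, w j * Real.negMulLog (p j)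
      ≤ (-Real.log x - 1) * ∑ j ∈ F, p j * w j + q := fun F => by
    have htangent : ∑ j ∈ F, w j * Real.negMulLog (p j)
        ≤ ∑ j ∈ F, ((-Real.log x - 1) * (p j * w j) + x * w j) :=
      Finset.sum_le_sum fun j _ => by
        linarith [mul_le_mul_of_nonneg_left (negMulLog_le_sub (hp j) hx0) (hw j)]
    rw [Finset.sum_add_distrib, ← Finset.mul_sum, ← Finset.mul_sum] at htangent
    have hmass := mul_le_mul_of_nonneg_left (hrow F) hx0.le
    rw [hx, div_mul_cancel₀ _ (Real.exp_pos a).ne', ← hx] at hmass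
    linarith
  have hpartial : Tendsto (fun F : Finset κ => ∑ j ∈ F, p j * w j) atTop (𝓝 q) := hsum
  have hlim : Tendsto (fun F : Finset κ => (-Real.log x - 1) * ∑ j ∈ F, p j * w j + q) atTop
      (𝓝 (Real.negMulLog q + a * q)) := by
    convert (hpartial.const_mul (-Real.log x - 1)).add_const q using 2
    rw [hx, Real.negMulLog, Real.log_div hq.ne' (Real.exp_pos a).ne', Real.log_exp]
    ring
  refine le_of_tendsto_of_tendsto' ENNReal.summable.hasSum (ENNReal.tendsto_ofReal hlim) fun F => ?_
  rw [← ENNReal.ofReal_sum_of_nonneg fun j _ => mul_nonneg (hw j) (hnp j)]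
  exact ENNReal.ofReal_le_ofReal (hbound F)

theorem tsum_negMulLog_le_of_transition (hp : ∀ j, 0 ≤ p j) (hnp : ∀ j, 0 ≤ Real.negMulLog (p j))
    {q : ι → ℝ} (hq : HasSum q 1) (hnq : ∀ i, 0 ≤ Real.negMulLog (q i)) (ha : 0 ≤ a)
    {T : ι → κ → ℝ} (hT : ∀ i j, 0 ≤ T i j)
    (hrow : ∀ i (F : Finset κ), ∑ j ∈ F, T i j ≤ Real.exp a)
    (hcol : ∀ j, p j ≠ 0 → 1 ≤ ∑' i, ENNReal.ofReal (T i j))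
    (hsum : ∀ i, HasSum (fun j => p j * T i j) (q i)) :
    ∑' j, ENNReal.ofReal (Real.negMulLog (p j))
      ≤ ∑' i, ENNReal.ofReal (Real.negMulLog (q i)) + ENNReal.ofReal a := by
  have haq : ∀ i, 0 ≤ a * q i := fun i =>
    mul_nonneg ha ((hsum i).nonneg fun j => mul_nonneg (hp j) (hT i j))
  calc ∑' j, ENNReal.ofReal (Real.negMulLog (p j))
      ≤ ∑' j, (∑' i, ENNReal.ofReal (T i j)) * ENNReal.ofReal (Real.negMulLog (p j)) := by
        refine ENNReal.tsum_le_tsum fun j => ?_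
        by_cases hj : p j = 0
        · simp [hj]
        · exact le_mul_of_one_le_left' (hcol j hj)
    _ = ∑' i, ∑' j, ENNReal.ofReal (T i j * Real.negMulLog (p j)) := by
        simp only [ENNReal.ofReal_mul (hT _ _), ← ENNReal.tsum_mul_right]
        rw [ENNReal.tsum_comm]
    _ ≤ ∑' i, (ENNReal.ofReal (Real.negMulLog (q i)) + ENNReal.ofReal (a * q i)) :=
        ENNReal.tsum_le_tsum fun i =>
          (tsum_mul_negMulLog_le hp hnp (hT i) (hrow i) (hsum i)).trans_eq
            (ENNReal.ofReal_add (hnq i) (haq i))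
    _ = _ := by
        rw [ENNReal.tsum_add, ← ENNReal.ofReal_tsum_of_nonneg haq (hq.summable.mul_left a),
          tsum_mul_left, hq.tsum_eq, mul_one]

end EntropyInequality

section Orbit

variable {H : Type*} [NormedAddCommGroup H] [InnerProductSpace ℂ H]
  {fock : HilbertBasis ℕ ℂ H} {γp γm : ℝ} {r : ℝ → H →L[ℂ] H} {s t : ℝ}

theorem IsOrbit.comp_const_add (hr : IsOrbit fock γp γm r) (ht : 0 ≤ t) :
    IsOrbit fock γp γm fun s => r (t + s) := by
  refine ⟨fun s hs => hr.1 _ (add_nonneg ht hs), fun m n s hs => ?_⟩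
  have hshift : HasDerivWithinAt (fun s => t + s) 1 (Set.Ici 0) s :=
    ((hasDerivAt_id s).const_add t).hasDerivWithinAt
  simpa [Function.comp_def] using (hr.2 m n (t + s) (add_nonneg ht hs)).scomp (t' := Set.Ici 0) s
    hshift fun x hx => add_nonneg ht hx

theorem eq_of_re_inner_eq_of_norm_eq_one {S T : H →L[ℂ] H} (hS : S.IsSymmetric)
    (hT : T.IsSymmetric) (h : ∀ x, ‖x‖ = 1 → (⟪x, S x⟫_ℂ).re = (⟪x, T x⟫_ℂ).re) : S = T := by
  have hre : ∀ x, (⟪x, S x⟫_ℂ).re = (⟪x, T x⟫_ℂ).re := fun x => by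
    rcases eq_or_ne x 0 with rfl | hx
    · simp
    · have hunit := h (((‖x‖⁻¹ : ℝ) : ℂ) • x) (by simp [norm_smul, hx])
      simpa [inner_smul_left, inner_smul_right, hx] using hunit
  have hinner : ∀ x, ⟪S x, x⟫_ℂ = ⟪T x, x⟫_ℂ := fun x => by
    calc ⟪S x, x⟫_ℂ = ⟪x, S x⟫_ℂ := hS x x
      _ = ((⟪x, S x⟫_ℂ).re : ℂ) := (hS.coe_re_inner_self_apply x).symm
      _ = ((⟪x, T x⟫_ℂ).re : ℂ) := by rw [hre x]
      _ = ⟪x, T x⟫_ℂ := hT.coe_re_inner_self_apply x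
      _ = ⟪T x, x⟫_ℂ := (hT x x).symm
  exact ContinuousLinearMap.coe_injective ((ext_inner_map _ _).mp hinner)

variable [CompleteSpace H]

theorem IsOrbit.vnEntropy_zero_le (hγp : 0 ≤ γp) (hγm : 0 ≤ γm) (hr : IsOrbit fock γp γm r)
    (ht : 0 ≤ t) :
    vnEntropy fock (r 0) ≤ vnEntropy fock (r t) + ENNReal.ofReal (|γm - γp| * t) := by
  have h0 := hr.1 0 le_rfl
  have h1 := hr.1 t ht
  obtain ⟨κ, f, p, hf⟩ := h0.exists_eigenbasis
  obtain ⟨ι, e, q, he⟩ := h1.exists_eigenbasis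
  rw [h0.vnEntropy_eq_tsum_negMulLog hf, h1.vnEntropy_eq_tsum_negMulLog he]
  refine tsum_negMulLog_le_of_transition (T := fun i j => transition fock γp γm t (e i) (f j))
    (h0.eigenvalue_nonneg hf) (h0.negMulLog_eigenvalue_nonneg hf) (h1.hasSum_eigenvalue he)
    (h1.negMulLog_eigenvalue_nonneg he) (by positivity)
    (fun i j => transition_nonneg hγp hγm ht (e i) (f.orthonormal.1 j))
    (fun i F => (sum_transition_le hγp hγm ht (e.orthonormal.1 i) f.orthonormal F).trans ?_)
    (fun j hj => hr.one_le_tsum_transition hγp hγm ht hf he hj) fun i => ?_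
  · exact Real.exp_le_exp.mpr (mul_le_mul_of_nonneg_right (le_abs_self _) ht)
  · simpa [he, inner_smul_right, e.orthonormal.1 i] using
      hr.hasSum_mul_transition hγp hγm ht hf (e.orthonormal.1 i)

theorem IsOrbit.vnEntropy_le (hγp : 0 ≤ γp) (hγm : 0 ≤ γm) (hr : IsOrbit fock γp γm r)
    (hs : 0 ≤ s) (hst : s ≤ t) :
    vnEntropy fock (r s) ≤ vnEntropy fock (r t) + ENNReal.ofReal (|γm - γp| * (t - s)) := by
  simpa using (hr.comp_const_add hs).vnEntropy_zero_le hγp hγm (sub_nonneg.mpr hst)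

theorem IsOrbit.eq_of_zero_eq (hγp : 0 ≤ γp) (hγm : 0 ≤ γm) {r' : ℝ → H →L[ℂ] H}
    (hr : IsOrbit fock γp γm r) (hr' : IsOrbit fock γp γm r') (h0 : r 0 = r' 0) (ht : 0 ≤ t) :
    r t = r' t := by
  obtain ⟨κ, f, p, hf⟩ := (hr.1 0 le_rfl).exists_eigenbasis
  refine eq_of_re_inner_eq_of_norm_eq_one (hr.1 t ht).1.isSymmetric (hr'.1 t ht).1.isSymmetric
    fun x hx => ?_
  exact (hr.hasSum_mul_transition hγp hγm ht hf hx).unique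
    (hr'.hasSum_mul_transition hγp hγm ht (fun j => h0 ▸ hf j) hx)

end Orbit

section ThermalWeight

/-- The photon number distribution of the thermal state of mean photon number `n`. -/
def thermalWeight (n : ℝ) (l : ℕ) : ℝ := n ^ l / (1 + n) ^ (l + 1)

variable {γp γm n : ℝ}

theorem thermalWeight_nonneg (hn : 0 ≤ n) (l : ℕ) : 0 ≤ thermalWeight n l := by
  rw [thermalWeight]
  positivity

theorem thermalWeight_eq_geometric (n : ℝ) (l : ℕ) :
    thermalWeight n l = (n / (1 + n)) ^ l * (1 + n)⁻¹ := by
  rw [thermalWeight, div_pow, pow_succ, ← div_div, div_eq_mul_inv _ (1 + n)]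

theorem norm_div_one_add_lt_one (hn : 0 ≤ n) : ‖n / (1 + n)‖ < 1 := by
  rw [Real.norm_of_nonneg (by positivity), div_lt_one (by positivity)]
  linarith

theorem hasSum_thermalWeight (hn : 0 ≤ n) : HasSum (thermalWeight n) 1 := by
  have hgeom := (hasSum_geometric_of_norm_lt_one (norm_div_one_add_lt_one hn)).mul_right (1 + n)⁻¹
  have hone : (1 - n / (1 + n))⁻¹ * (1 + n)⁻¹ = 1 := by
    rw [one_sub_div (by positivity), add_sub_cancel_right, one_div, inv_inv,
      mul_inv_cancel₀ (by positivity)]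
  rw [hone] at hgeom
  simpa only [← thermalWeight_eq_geometric] using hgeom

theorem hasSum_mul_thermalWeight (hn : 0 ≤ n) :
    HasSum (fun l : ℕ => (l : ℝ) * thermalWeight n l) n := by
  have hgeom := (hasSum_coe_mul_geometric_of_norm_lt_one (norm_div_one_add_lt_one hn)).mul_right
    (1 + n)⁻¹
  have hmean : n / (1 + n) / (1 - n / (1 + n)) ^ 2 * (1 + n)⁻¹ = n := by
    rw [one_sub_div (by positivity), add_sub_cancel_right]
    field_simp
  rw [hmean] at hgeom
  simpa only [mul_assoc, ← thermalWeight_eq_geometric] using hgeom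

theorem negMulLog_thermalWeight (hn : 0 < n) (l : ℕ) :
    Real.negMulLog (thermalWeight n l)
      = l * thermalWeight n l * (Real.log (1 + n) - Real.log n)
        + thermalWeight n l * Real.log (1 + n) := by
  have hlog : Real.log (thermalWeight n l) = l * Real.log n - (l + 1) * Real.log (1 + n) := by
    rw [thermalWeight, Real.log_div (by positivity) (by positivity), Real.log_pow, Real.log_pow,
      Nat.cast_add_one]
  rw [Real.negMulLog, hlog]
  ring

theorem hasSum_negMulLog_thermalWeight (hn : 0 ≤ n) :
    HasSum (fun l => Real.negMulLog (thermalWeight n l)) (thermalEntropy n) := by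
  rcases hn.eq_or_lt with rfl | hpos
  · have hzero : ∀ l, Real.negMulLog (thermalWeight 0 l) = 0 := fun l => by
      cases l <;> simp [thermalWeight]
    simp [hzero, thermalEntropy]
  · have hentropy : thermalEntropy n
        = n * (Real.log (1 + n) - Real.log n) + 1 * Real.log (1 + n) := by
      rw [thermalEntropy, add_comm n 1]
      ring
    simp only [negMulLog_thermalWeight hpos, hentropy]
    exact ((hasSum_mul_thermalWeight hn).mul_right _).add ((hasSum_thermalWeight hn).mul_right _)

theorem hasDerivAt_thermalWeight (hn : 0 ≤ n) (l : ℕ) :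
    HasDerivAt (fun n => thermalWeight n l)
      ((l * n ^ (l - 1) * (1 + n) - (l + 1) * n ^ l) / (1 + n) ^ (l + 2)) n := by
  have hdiv := (hasDerivAt_pow l n).fun_div (((hasDerivAt_id n).const_add 1).fun_pow (l + 1))
    (pow_ne_zero _ (by positivity : (1 + n) ≠ 0))
  refine hdiv.congr_deriv ?_
  simp only [id, Nat.add_sub_cancel, mul_one]
  rw [div_eq_div_iff (by positivity) (by positivity)]
  push_cast
  ring

-- A thermal state stays thermal: its mean photon number moves with speed `γ₊ (n + 1) - γ₋ n`.
theorem hasDerivAt_thermalWeight_comp {f : ℝ → ℝ} {t : ℝ} (hft : 0 ≤ f t)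
    (hf : HasDerivAt f (γp * (f t + 1) - γm * f t) t) (l : ℕ) :
    HasDerivAt (fun s => thermalWeight (f s) l)
      (populationGain γp γm (thermalWeight (f t)) l - lossRate γp γm l * thermalWeight (f t) l)
      t := by
  refine ((hasDerivAt_thermalWeight hft l).comp t hf).congr_deriv ?_
  have : 1 + f t ≠ 0 := by positivity
  cases l <;>
  · simp only [populationGain, lossRate, thermalWeight, Nat.add_sub_cancel]
    field_simp
    push_cast
    ring

end ThermalWeight

section ThermalState

open scoped ComplexOrder

theorem gain_diagonal (γp γm : ℝ) (y : ℕ → ℝ) :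
    gain γp γm (Matrix.diagonal fun l => (y l : ℂ))
      = Matrix.diagonal fun l => (populationGain γp γm y l : ℂ) := by
  ext j k
  rcases eq_or_ne j k with rfl | hjk
  · simp only [gain, Matrix.of_apply, Matrix.diagonal_apply_eq, populationGain, Complex.real_smul,
      Real.mul_self_sqrt (Nat.cast_nonneg (α := ℝ) j),
      Real.mul_self_sqrt (Nat.cast_add_one_pos (α := ℝ) j).le]
    push_cast
    rfl
  · rw [Matrix.diagonal_apply_ne _ hjk, gain, Matrix.of_apply,
      Matrix.diagonal_apply_ne _ (by omega : j + 1 ≠ k + 1), smul_zero, add_zero]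
    -- At level `0` the truncated subtraction is harmless: there the rate vanishes.
    rcases Nat.eq_zero_or_pos j with rfl | hj
    · simp
    rcases Nat.eq_zero_or_pos k with rfl | hk
    · simp
    rw [Matrix.diagonal_apply_ne _ (by omega), smul_zero]

theorem isMasterSolution_diagonal {γp γm : ℝ} {y : ℝ → ℕ → ℝ}
    (hy : ∀ l t, 0 ≤ t → HasDerivWithinAt (fun s => y s l)
      (populationGain γp γm (y t) l - lossRate γp γm l * y t l) (Set.Ici 0) t) :
    IsMasterSolution γp γm fun t => Matrix.diagonal fun l => (y t l : ℂ) := by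
  intro j k t ht
  simp only [gain_diagonal]
  rcases eq_or_ne j k with rfl | hjk
  · have hdecay : decayRate γp γm j j = lossRate γp γm j := add_self_div_two _
    simpa [hdecay] using (hy j t ht).ofReal_comp
  · simpa [Matrix.diagonal_apply_ne _ hjk] using hasDerivWithinAt_const t (Set.Ici 0) (0 : ℂ)

theorem IsMasterSolution.congr {γp γm : ℝ} {Y Y' : ℝ → Matrix ℕ ℕ ℂ}
    (hY : IsMasterSolution γp γm Y) (h : ∀ t, 0 ≤ t → Y' t = Y t) :
    IsMasterSolution γp γm Y' := fun j k t ht => by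
  rw [h t ht]
  exact (hY j k t ht).congr_of_mem (fun s hs => by rw [h s hs]) ht

variable {H : Type*} [NormedAddCommGroup H] [InnerProductSpace ℂ H] [CompleteSpace H]
  {γp γm n : ℝ}

theorem hasSum_thermal (fock : HilbertBasis ℕ ℂ H) (hn : 0 ≤ n) :
    HasSum (fun l : ℕ => (thermalWeight n l : ℂ) •
      (InnerProductSpace.rankOne ℂ (fock l) (fock l) : H →L[ℂ] H)) (thermal fock n) := by
  refine (Summable.of_norm ((hasSum_thermalWeight hn).summable.congr fun l => ?_)).hasSum
  rw [norm_smul, InnerProductSpace.norm_rankOne, fock.orthonormal.1 l, Complex.norm_real,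
    Real.norm_of_nonneg (thermalWeight_nonneg hn l), mul_one, mul_one]

theorem thermal_apply_fock (fock : HilbertBasis ℕ ℂ H) (hn : 0 ≤ n) (k : ℕ) :
    thermal fock n (fock k) = (thermalWeight n k : ℂ) • fock k := by
  refine ((hasSum_thermal fock hn).mapL (ContinuousLinearMap.apply ℂ H (fock k))).unique ?_
  convert hasSum_single k fun l hl => ?_ using 1
  · simp [fock.orthonormal.1 k]
  · simp [orthonormal_iff_ite.mp fock.orthonormal, hl]

theorem fockMatrix_thermal (fock : HilbertBasis ℕ ℂ H) (hn : 0 ≤ n) :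
    fockMatrix fock (thermal fock n) = Matrix.diagonal fun l => (thermalWeight n l : ℂ) := by
  ext j k
  rw [fockMatrix_apply, thermal_apply_fock fock hn, inner_smul_right,
    orthonormal_iff_ite.mp fock.orthonormal, mul_ite, mul_one, mul_zero, Matrix.diagonal_apply]
  rcases eq_or_ne j k with rfl | hjk
  · rfl
  · simp only [if_neg hjk]

theorem isPositive_thermal (fock : HilbertBasis ℕ ℂ H) (hn : 0 ≤ n) :
    (thermal fock n).IsPositive := by
  rw [← ContinuousLinearMap.nonneg_iff_isPositive]
  refine (hasSum_thermal fock hn).nonneg fun l => ?_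
  rw [ContinuousLinearMap.nonneg_iff_isPositive]
  exact (InnerProductSpace.isPositive_rankOne_self _).smul_of_nonneg
    (Complex.zero_le_real.mpr (thermalWeight_nonneg hn l))

theorem isDensity_thermal (fock : HilbertBasis ℕ ℂ H) (hn : 0 ≤ n) :
    IsDensity fock (thermal fock n) := by
  refine ⟨isPositive_thermal fock hn, ?_⟩
  simp only [← fockMatrix_apply, fockMatrix_thermal fock hn, Matrix.diagonal_apply_eq]
  simpa using Complex.hasSum_ofReal.mpr (hasSum_thermalWeight hn)

theorem vnEntropy_thermal (fock : HilbertBasis ℕ ℂ H) (hn : 0 ≤ n) :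
    vnEntropy fock (thermal fock n) = ENNReal.ofReal (thermalEntropy n) := by
  have hfock := thermal_apply_fock fock hn
  have hdensity := isDensity_thermal fock hn
  rw [hdensity.vnEntropy_eq_tsum_negMulLog hfock,
    ← ENNReal.ofReal_tsum_of_nonneg (hdensity.negMulLog_eigenvalue_nonneg hfock)
      (hasSum_negMulLog_thermalWeight hn).summable, (hasSum_negMulLog_thermalWeight hn).tsum_eq]

/-- The mean photon number at time `t` of the orbit started in the thermal state of mean photon
number `n`: the solution of `f' = γ₊ (f + 1) - γ₋ f` with `f 0 = n`. -/
def meanPhotons (γp γm n : ℝ) : ℝ → ℝ := duhamel (γm - γp) n fun _ => γp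

theorem meanPhotons_zero (γp γm n : ℝ) : meanPhotons γp γm n 0 = n := duhamel_zero_right ..

theorem meanPhotons_nonneg (hγp : 0 ≤ γp) (hn : 0 ≤ n) {t : ℝ} (ht : 0 ≤ t) :
    0 ≤ meanPhotons γp γm n t := by
  simpa [duhamel, meanPhotons] using duhamel_mono (κ := γm - γp) (continuousOn_const (c := (0 : ℝ)))
    (continuousOn_const (c := γp)) ht hn fun _ _ => hγp

theorem hasDerivAt_meanPhotons (γp γm n t : ℝ) :
    HasDerivAt (meanPhotons γp γm n)
      (γp * (meanPhotons γp γm n t + 1) - γm * meanPhotons γp γm n t) t :=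
  (hasDerivAt_duhamel continuous_const (γm - γp) n t).congr_deriv <| by
    rw [meanPhotons, smul_eq_mul]
    ring

theorem isOrbit_thermal (fock : HilbertBasis ℕ ℂ H) (hγp : 0 ≤ γp) (hn : 0 ≤ n) :
    IsOrbit fock γp γm fun t => thermal fock (meanPhotons γp γm n t) := by
  have hnonneg : ∀ t : ℝ, 0 ≤ t → 0 ≤ meanPhotons γp γm n t := fun t ht =>
    meanPhotons_nonneg hγp hn ht
  refine isOrbit_iff.mpr ⟨fun t ht => isDensity_thermal fock (hnonneg t ht), ?_⟩
  refine (isMasterSolution_diagonal (y := fun t => thermalWeight (meanPhotons γp γm n t))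
    fun l t ht => ?_).congr fun t ht => fockMatrix_thermal fock (hnonneg t ht)
  exact (hasDerivAt_thermalWeight_comp (hnonneg t ht)
    (hasDerivAt_meanPhotons γp γm n t) l).hasDerivWithinAt

end ThermalState

section ThermalEntropy

variable {n : ℝ}

theorem hasDerivAt_thermalEntropy (hn : 0 < n) :
    HasDerivAt thermalEntropy (Real.log (n + 1) - Real.log n) n := by
  have hsucc := (Real.hasDerivAt_mul_log (x := n + 1) (by positivity)).comp_add_const n 1
  exact (hsucc.sub (Real.hasDerivAt_mul_log hn.ne')).congr_deriv (by ring)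

theorem continuous_thermalEntropy : Continuous thermalEntropy :=
  (Real.continuous_mul_log.comp (continuous_add_const 1)).sub Real.continuous_mul_log

theorem one_div_le_log_sub_log (hn : 0 < n) :
    1 / (n + 1) ≤ Real.log (n + 1) - Real.log n := by
  have hlog := Real.one_sub_inv_le_log_of_pos (x := (n + 1) / n) (by positivity)
  rw [Real.log_div (by positivity) hn.ne', inv_div] at hlog
  refine le_of_eq_of_le ?_ hlog
  field_simp
  ring

theorem sub_div_le_thermalEntropy_sub {a b B : ℝ} (ha : 0 ≤ a) (hab : a ≤ b) (hb : b ≤ B) :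
    (b - a) / (B + 1) ≤ thermalEntropy b - thermalEntropy a := by
  have hderiv : ∀ x ∈ Set.Ioo a b, HasDerivAt thermalEntropy (Real.log (x + 1) - Real.log x) x :=
    fun x hx => hasDerivAt_thermalEntropy (ha.trans_lt hx.1)
  rw [div_eq_inv_mul]
  refine (convex_Icc a b).mul_sub_le_image_sub_of_le_deriv continuous_thermalEntropy.continuousOn
    (fun x hx => ?_) (fun x hx => ?_) a (Set.left_mem_Icc.mpr hab) b (Set.right_mem_Icc.mpr hab) hab
  all_goals rw [interior_Icc] at hx
  · exact (hderiv x hx).differentiableAt.differentiableWithinAt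
  · rw [(hderiv x hx).deriv, ← one_div]
    refine le_trans ?_ (one_div_le_log_sub_log (ha.trans_lt hx.1))
    exact one_div_le_one_div_of_le (by linarith [hx.1]) (by linarith [hx.2])

theorem strictMonoOn_thermalEntropy : StrictMonoOn thermalEntropy (Set.Ici 0) :=
  fun a ha b _ hab => sub_pos.mp <| (div_pos (sub_pos.mpr hab)
    (by linarith [Set.mem_Ici.mp ha])).trans_le (sub_div_le_thermalEntropy_sub ha hab.le le_rfl)

theorem thermalEntropy_zero : thermalEntropy 0 = 0 := by simp [thermalEntropy]

theorem thermalEntropy_nonneg (hn : 0 ≤ n) : 0 ≤ thermalEntropy n :=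
  thermalEntropy_zero.symm.trans_le (strictMonoOn_thermalEntropy.monotoneOn Set.self_mem_Ici hn hn)

theorem log_add_one_le_thermalEntropy (hn : 0 ≤ n) : Real.log (n + 1) ≤ thermalEntropy n := by
  rcases hn.eq_or_lt with rfl | hpos
  · simp [thermalEntropy]
  · have hlog := mul_le_mul_of_nonneg_left
      (Real.log_le_log hpos (le_add_of_nonneg_right one_pos.le)) hn
    rw [thermalEntropy]
    linarith

theorem bijOn_thermalEntropy : Set.BijOn thermalEntropy (Set.Ici 0) (Set.Ici 0) := by
  refine ⟨fun n hn => thermalEntropy_nonneg hn, strictMonoOn_thermalEntropy.injOn, fun s hs => ?_⟩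
  have hexp : 0 ≤ Real.exp s - 1 := sub_nonneg.mpr (Real.one_le_exp hs)
  have hle := log_add_one_le_thermalEntropy hexp
  rw [sub_add_cancel, Real.log_exp] at hle
  obtain ⟨n, hn, rfl⟩ := intermediate_value_Icc hexp continuous_thermalEntropy.continuousOn
    ⟨thermalEntropy_zero.trans_le hs, hle⟩
  exact ⟨n, hn.1, rfl⟩

end ThermalEntropy

section Purity

variable {H : Type*} [NormedAddCommGroup H] [InnerProductSpace ℂ H] {fock : HilbertBasis ℕ ℂ H}
  {γp γm : ℝ} {r : ℝ → H →L[ℂ] H} {ρ : H →L[ℂ] H} {t : ℝ}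

theorem lindblad_add_left (ρ : H →L[ℂ] H) (u u' v : ℕ →₀ ℂ) :
    lindblad fock γp γm ρ (u + u') v
      = lindblad fock γp γm ρ u v + lindblad fock γp γm ρ u' v := by
  simp only [lindblad, lindbladPlus, lindbladMinus, matrixElement, map_add, inner_add_left]
  ring

theorem lindblad_add_right (ρ : H →L[ℂ] H) (u v v' : ℕ →₀ ℂ) :
    lindblad fock γp γm ρ u (v + v')
      = lindblad fock γp γm ρ u v + lindblad fock γp γm ρ u v' := by
  simp only [lindblad, lindbladPlus, lindbladMinus, matrixElement, map_add, inner_add_right]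
  ring

theorem lindblad_smul_smul (ρ : H →L[ℂ] H) (a b : ℂ) (u v : ℕ →₀ ℂ) :
    lindblad fock γp γm ρ (a • u) (b • v) = star a * b * lindblad fock γp γm ρ u v := by
  simp only [lindblad, lindbladPlus, lindbladMinus, matrixElement, map_smul, inner_smul_left,
    inner_smul_right, RCLike.star_def]
  ring

theorem IsOrbit.hasDerivWithinAt_matrixElement (hr : IsOrbit fock γp γm r) (ht : 0 ≤ t)
    (u v : ℕ →₀ ℂ) :
    HasDerivWithinAt (fun s => matrixElement fock (r s) u v) (lindblad fock γp γm (r t) u v)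
      (Set.Ici 0) t := by
  induction u using Finsupp.induction_linear with
  | zero => simpa [lindblad, lindbladPlus, lindbladMinus, matrixElement]
      using hasDerivWithinAt_const t (Set.Ici 0) (0 : ℂ)
  | add u u' hu hu' =>
    rw [lindblad_add_left]
    simpa only [matrixElement, map_add, inner_add_left] using hu.fun_add hu'
  | single j a =>
    induction v using Finsupp.induction_linear with
    | zero => simpa [lindblad, lindbladPlus, lindbladMinus, matrixElement]
        using hasDerivWithinAt_const t (Set.Ici 0) (0 : ℂ)
    | add v v' hv hv' =>
      rw [lindblad_add_right]
      simpa only [matrixElement, map_add, inner_add_right] using hv.fun_add hv'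
    | single k b =>
      rw [← Finsupp.smul_single_one j a, ← Finsupp.smul_single_one k b, lindblad_smul_smul]
      refine ((hr.2 j k t ht).const_mul (star a * b)).congr_of_mem (fun s _ => ?_) ht
      simp only [matrixElement, map_smul, inner_smul_left, inner_smul_right, RCLike.star_def]
      ring

theorem matrixElement_rankOne (x : H) (u v : ℕ →₀ ℂ) :
    matrixElement fock (InnerProductSpace.rankOne ℂ x x) u v
      = ⟪Finsupp.linearCombination ℂ fock u, x⟫_ℂ
        * star ⟪Finsupp.linearCombination ℂ fock v, x⟫_ℂ := by
  rw [matrixElement, InnerProductSpace.rankOne_apply, inner_smul_right, RCLike.star_def,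
    inner_conj_symm, mul_comm]

theorem re_lindblad_rankOne_of_inner_eq_zero {x : H} {v : ℕ →₀ ℂ}
    (hv : ⟪Finsupp.linearCombination ℂ fock v, x⟫_ℂ = 0) :
    (lindblad fock γp γm (InnerProductSpace.rankOne ℂ x x) v v).re
      = γp * ‖⟪Finsupp.linearCombination ℂ fock (annihilate v), x⟫_ℂ‖ ^ 2
        + γm * ‖⟪Finsupp.linearCombination ℂ fock (create v), x⟫_ℂ‖ ^ 2 := by
  simp only [lindblad, lindbladPlus, lindbladMinus, matrixElement_rankOne, hv, star_zero, mul_zero,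
    zero_mul, sub_zero, RCLike.star_def, Complex.mul_conj']
  norm_cast

-- `⟨v|r s|v⟩` is non-negative and vanishes at the interior time `t`, so its derivative vanishes.
theorem IsOrbit.inner_annihilate_eq_zero (hγp : 0 < γp) (hγm : 0 ≤ γm) (hr : IsOrbit fock γp γm r)
    (ht : 0 < t) {x : H} (hx : r t = InnerProductSpace.rankOne ℂ x x) {v : ℕ →₀ ℂ}
    (hv : ⟪Finsupp.linearCombination ℂ fock v, x⟫_ℂ = 0) :
    ⟪Finsupp.linearCombination ℂ fock (annihilate v), x⟫_ℂ = 0 := by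
  have hderiv : HasDerivAt (fun s => (matrixElement fock (r s) v v).re)
      (lindblad fock γp γm (r t) v v).re t :=
    Complex.reCLM.hasFDerivAt.comp_hasDerivAt t
      ((hr.hasDerivWithinAt_matrixElement ht.le v v).hasDerivAt (Ici_mem_nhds ht))
  have hmin : IsLocalMin (fun s => (matrixElement fock (r s) v v).re) t := by
    filter_upwards [Ici_mem_nhds ht] with s hs
    rw [hx, matrixElement_rankOne, hv, zero_mul]
    exact (Complex.nonneg_iff.mp ((hr.1 s hs).1.inner_nonneg_right _)).1
  have hzero := hmin.hasDerivAt_eq_zero hderiv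
  rw [hx, re_lindblad_rankOne_of_inner_eq_zero hv] at hzero
  have hsq := ((add_eq_zero_iff_of_nonneg (by positivity) (by positivity)).mp hzero).1
  simpa [hγp.ne'] using hsq

theorem exists_inner_annihilate_ne_zero (fock : HilbertBasis ℕ ℂ H) {x : H} (hx : x ≠ 0) :
    ∃ v : ℕ →₀ ℂ, ⟪Finsupp.linearCombination ℂ fock v, x⟫_ℂ = 0 ∧
      ⟪Finsupp.linearCombination ℂ fock (annihilate v), x⟫_ℂ ≠ 0 := by
  classical
  have hex : ∃ l, ⟪fock l, x⟫_ℂ ≠ 0 := by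
    by_contra! hzero
    exact hx (fock.repr.map_eq_zero_iff.mp (lp.ext (funext fun l => by
      simpa [fock.repr_apply_apply] using hzero l)))
  -- Let `l` be the lowest occupied level; `v` combines the levels `l` and `l + 1`.
  set l := Nat.find hex
  have hl : ⟪fock l, x⟫_ℂ ≠ 0 := Nat.find_spec hex
  have hbelow : ⟪fock (l - 1), x⟫_ℂ * (√l : ℝ) = 0 := by
    rcases Nat.eq_zero_or_pos l with h | h
    · simp [h]
    · rw [not_not.mp (Nat.find_min hex (Nat.sub_lt h one_pos)), zero_mul]
  refine ⟨Finsupp.single l (star ⟪fock (l + 1), x⟫_ℂ)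
    - Finsupp.single (l + 1) (star ⟪fock l, x⟫_ℂ), ?_, ?_⟩
  · simp only [map_sub, Finsupp.linearCombination_single, inner_sub_left, inner_smul_left,
      RCLike.star_def, Complex.conj_conj]
    ring
  · simp only [map_sub, annihilate_single, Nat.add_sub_cancel, Finsupp.linearCombination_single,
      inner_sub_left, inner_smul_left, map_mul, RCLike.star_def, Complex.conj_conj,
      Complex.conj_ofReal]
    rw [mul_assoc, mul_comm (√l : ℂ), hbelow, mul_zero, zero_sub, neg_ne_zero]
    exact mul_ne_zero (mul_ne_zero hl (by norm_cast; positivity)) hl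

variable [CompleteSpace H]

theorem IsDensity.exists_eq_rankOne_of_vnEntropy_eq_zero (h : IsDensity fock ρ)
    (h0 : vnEntropy fock ρ = 0) :
    ∃ x : H, x ≠ 0 ∧ ρ = InnerProductSpace.rankOne ℂ x x := by
  classical
  obtain ⟨ι, e, p, he⟩ := h.exists_eigenbasis
  have hp := h.hasSum_eigenvalue he
  have hnonneg := h.eigenvalue_nonneg he
  rw [h.vnEntropy_eq_tsum_negMulLog he, ENNReal.tsum_eq_zero] at h0
  have hvalue : ∀ i, p i = 0 ∨ p i = 1 := fun i => by
    have hlog := (ENNReal.ofReal_eq_zero.mp (h0 i)).antisymm (h.negMulLog_eigenvalue_nonneg he i)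
    rw [Real.negMulLog, mul_eq_zero, neg_eq_zero, Real.log_eq_zero] at hlog
    rcases hlog with h | h | h | h
    exacts [Or.inl h, Or.inl h, Or.inr h, by linarith [hnonneg i]]
  obtain ⟨i₀, hi₀⟩ : ∃ i, p i ≠ 0 := by
    by_contra! hzero
    exact zero_ne_one ((funext hzero ▸ hasSum_zero).unique hp)
  have hone := (hvalue i₀).resolve_left hi₀
  have hother : ∀ i, i ≠ i₀ → p i = 0 := fun i hi => by
    have hle := sum_le_hasSum {i, i₀} (fun j _ => hnonneg j) hp
    rw [Finset.sum_pair hi, hone] at hle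
    linarith [hnonneg i]
  refine ⟨e i₀, e.orthonormal.ne_zero i₀, ContinuousLinearMap.ext_on
    (Submodule.dense_iff_topologicalClosure_eq_top.mpr e.dense_span) ?_⟩
  rintro _ ⟨i, rfl⟩
  rw [he, InnerProductSpace.rankOne_apply, orthonormal_iff_ite.mp e.orthonormal]
  rcases eq_or_ne i i₀ with rfl | hi
  · simp [hone]
  · simp [hother i hi, hi.symm]

theorem IsOrbit.vnEntropy_ne_zero (hγp : 0 < γp) (hγm : 0 ≤ γm) (hr : IsOrbit fock γp γm r)
    (ht : 0 < t) : vnEntropy fock (r t) ≠ 0 := by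
  intro h0
  obtain ⟨x, hx, hpure⟩ := (hr.1 t ht.le).exists_eq_rankOne_of_vnEntropy_eq_zero h0
  obtain ⟨v, hv, hannihilate⟩ := exists_inner_annihilate_ne_zero fock hx
  exact hannihilate (hr.inner_annihilate_eq_zero hγp hγm ht hpure hv)

end Purity

/-- `f` decreases on `s` at rate at most `K`: a one-sided Lipschitz condition, equivalent to
monotonicity of `t ↦ f t + K * t` on `s`. It makes `f` differentiable almost everywhere while
still allowing upward jumps, which is all that is known of the output entropy. -/
def DescentRateLE (f : ℝ → ℝ) (K : ℝ) (s : Set ℝ) : Prop :=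
  ∀ x ∈ s, ∀ y ∈ s, x ≤ y → f x ≤ f y + K * (y - x)

section DescentRate

variable {f g u : ℝ → ℝ} {s : Set ℝ} {c K B M T : ℝ}

theorem DescentRateLE.monotoneOn (hf : DescentRateLE f K s) :
    MonotoneOn (fun t => f t + K * t) s := fun x hx y hy hxy => by
  dsimp only
  linarith [hf x hx y hy hxy]

theorem DescentRateLE.sub {L : NNReal} (hf : DescentRateLE f K s) (hg : LipschitzOnWith L g s) :
    DescentRateLE (fun t => f t - g t) (K + L) s := fun x hx y hy hxy => by
  have hlip := (le_abs_self _).trans (hg.dist_le_mul y hy x hx)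
  rw [Real.dist_eq, abs_of_nonneg (sub_nonneg.mpr hxy)] at hlip
  linarith [hf x hx y hy hxy]

theorem DescentRateLE.mul_left {L : NNReal} (hu : DescentRateLE u K s)
    (hg : LipschitzOnWith L g s) (hg0 : ∀ x ∈ s, 0 ≤ g x) (hM : ∀ x ∈ s, g x ≤ M)
    (hB : ∀ x ∈ s, |u x| ≤ B) :
    DescentRateLE (fun t => g t * u t) (M * |K| + L * B) s := fun x hx y hy hxy => by
  have hyx : 0 ≤ y - x := sub_nonneg.mpr hxy
  have hdescent : g y * (u x - u y) ≤ M * |K| * (y - x) :=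
    calc g y * (u x - u y) ≤ g y * (|K| * (y - x)) := by
          have := mul_le_mul_of_nonneg_right (le_abs_self K) hyx
          gcongr
          exacts [hg0 y hy, by linarith [hu x hx y hy hxy]]
      _ ≤ M * (|K| * (y - x)) := by
          gcongr
          exact hM y hy
      _ = M * |K| * (y - x) := by ring
  have hlip : (g x - g y) * u x ≤ L * B * (y - x) :=
    calc (g x - g y) * u x ≤ |g x - g y| * |u x| := (le_abs_self _).trans (abs_mul _ _).le
      _ ≤ L * (y - x) * B := by
          have h := hg.dist_le_mul x hx y hy
          rw [Real.dist_eq, Real.dist_eq, abs_sub_comm x y, abs_of_nonneg hyx] at h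
          gcongr
          exact hB x hx
      _ = L * B * (y - x) := by ring
  linarith

theorem DescentRateLE.abs_le (hu : DescentRateLE u K (Set.Icc 0 T)) {t : ℝ}
    (ht : t ∈ Set.Icc 0 T) : |u t| ≤ |u 0| + |u T| + |K| * T := by
  have hT : 0 ≤ T := ht.1.trans ht.2
  have hleft := hu 0 (Set.left_mem_Icc.mpr hT) t ht ht.1
  have hright := hu t ht T (Set.right_mem_Icc.mpr hT) ht.2
  have hKt : K * (t - 0) ≤ |K| * T :=
    mul_le_mul (le_abs_self K) (by linarith [ht.2]) (by linarith [ht.1]) (abs_nonneg K)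
  have hKT : K * (T - t) ≤ |K| * T :=
    mul_le_mul (le_abs_self K) (by linarith [ht.1]) (by linarith [ht.2]) (abs_nonneg K)
  rw [_root_.abs_le]
  constructor <;>
    linarith [neg_abs_le (u 0), le_abs_self (u T), abs_nonneg (u 0), abs_nonneg (u T)]

theorem DescentRateLE.exists_exp_mul (hu : DescentRateLE u K (Set.Icc 0 T)) (c : ℝ) :
    ∃ K', DescentRateLE (fun t => Real.exp (c * t) * u t) K' (Set.Icc 0 T) := by
  obtain ⟨L, hL⟩ := ContDiffOn.exists_lipschitzOnWith (s := Set.Icc 0 T) (n := 1)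
    (f := fun t : ℝ => Real.exp (c * t)) (by fun_prop) one_ne_zero (convex_Icc 0 T) isCompact_Icc
  refine ⟨_, hu.mul_left hL (fun t _ => Real.exp_nonneg _) (M := Real.exp (|c| * T))
    (fun t ht => Real.exp_le_exp.mpr ?_) fun t ht => hu.abs_le ht⟩
  exact mul_le_mul (le_abs_self c) ht.2 ht.1 (abs_nonneg c)

-- Lebesgue: a monotone function has a derivative almost everywhere, whose integral is at most the
-- increment of the function.
theorem DescentRateLE.le_of_deriv_nonneg (hT : 0 ≤ T) (hf : DescentRateLE f K (Set.Icc 0 T))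
    (hderiv : ∀ t ∈ Set.Ioo 0 T, ∀ d, HasDerivAt f d t → 0 ≤ d) : f 0 ≤ f T := by
  set φ : ℝ → ℝ := fun t => f t + K * t
  have hmono : MonotoneOn φ (Set.uIcc 0 T) := by
    rw [Set.uIcc_of_le hT]
    exact hf.monotoneOn
  have hincrement : ∫ t in (0 : ℝ)..T, deriv φ t ≤ φ T - φ 0 := by
    have hle : φ 0 ≤ φ T := hmono Set.left_mem_uIcc Set.right_mem_uIcc hT
    have hmem := hmono.intervalIntegral_deriv_mem_uIcc
    rw [Set.uIcc_of_le (sub_nonneg.mpr hle)] at hmem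
    exact hmem.2
  have hdrift : ∫ _ in (0 : ℝ)..T, K ≤ ∫ t in (0 : ℝ)..T, deriv φ t := by
    refine intervalIntegral.integral_mono_ae_restrict hT (by simp) hmono.intervalIntegrable_deriv ?_
    have hdiff := hf.monotoneOn.ae_differentiableWithinAt measurableSet_Icc
    rw [← MeasureTheory.restrict_Ioo_eq_restrict_Icc] at hdiff ⊢
    filter_upwards [hdiff, MeasureTheory.ae_restrict_mem measurableSet_Ioo] with t ht htT
    have hφ : HasDerivAt φ (deriv φ t) t :=
      (ht.differentiableAt (Icc_mem_nhds htT.1 htT.2)).hasDerivAt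
    have hf' : HasDerivAt f (deriv φ t - K) t := by
      simpa [φ] using hφ.fun_sub ((hasDerivAt_id t).const_mul K)
    linarith [hderiv t htT _ hf']
  simp only [intervalIntegral.integral_const, smul_eq_mul, sub_zero, φ] at hdrift hincrement
  linarith

theorem DescentRateLE.nonneg_of_gronwall (hT : 0 ≤ T) (hu : DescentRateLE u K (Set.Icc 0 T))
    (h0 : 0 ≤ u 0) (hderiv : ∀ t ∈ Set.Ioo 0 T, ∀ d, HasDerivAt u d t → 0 ≤ d + c * u t) :
    0 ≤ u T := by
  obtain ⟨K', hexp⟩ := hu.exists_exp_mul c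
  have hle := hexp.le_of_deriv_nonneg hT fun t ht d hd => by
    have hu' : HasDerivAt u (Real.exp (-c * t) * d - c * u t) t := by
      refine (((hasDerivAt_exp_mul (-c) t).fun_mul hd).congr_of_eventuallyEq
        (.of_forall fun s => ?_)).congr_deriv ?_
      · simp [← mul_assoc, ← Real.exp_add]
      · rw [show -c * Real.exp (-c * t) * (Real.exp (c * t) * u t)
          = -c * (Real.exp (-c * t) * Real.exp (c * t)) * u t by ring, ← Real.exp_add]
        simp [sub_eq_neg_add]
    have hnonneg := hderiv t ht _ hu'
    rw [sub_add_cancel] at hnonneg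
    exact nonneg_of_mul_nonneg_right hnonneg (Real.exp_pos _)
  have hfinal : 0 ≤ Real.exp (c * T) * u T := le_trans (by simpa using h0) hle
  exact nonneg_of_mul_nonneg_right hfinal (Real.exp_pos _)

end DescentRate

section EffectivePhotons

variable {H : Type*} [NormedAddCommGroup H] [InnerProductSpace ℂ H] [CompleteSpace H]
  {fock : HilbertBasis ℕ ℂ H} {γp γm : ℝ} {r : ℝ → H →L[ℂ] H} {ρ : H →L[ℂ] H} {n s t d T : ℝ}

/-- The mean photon number `g⁻¹(S(ρ))` of the thermal state with the entropy of `ρ`. If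
`S(ρ) = ∞` it has the junk value `g⁻¹(0) = 0`. -/
def effectivePhotons (fock : HilbertBasis ℕ ℂ H) (ρ : H →L[ℂ] H) : ℝ :=
  Function.invFunOn thermalEntropy (Set.Ici 0) (vnEntropy fock ρ).toReal

theorem effectivePhotons_nonneg : 0 ≤ effectivePhotons fock ρ :=
  Function.invFunOn_mem (bijOn_thermalEntropy.surjOn ENNReal.toReal_nonneg)

theorem vnEntropy_eq_ofReal_effectivePhotons (hρ : vnEntropy fock ρ ≠ ⊤) :
    vnEntropy fock ρ = ENNReal.ofReal (thermalEntropy (effectivePhotons fock ρ)) := by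
  rw [effectivePhotons, Function.invFunOn_eq (bijOn_thermalEntropy.surjOn ENNReal.toReal_nonneg),
    ENNReal.ofReal_toReal hρ]

theorem effectivePhotons_eq (hn : 0 ≤ n)
    (hρ : vnEntropy fock ρ = ENNReal.ofReal (thermalEntropy n)) : effectivePhotons fock ρ = n := by
  rw [effectivePhotons, hρ, ENNReal.toReal_ofReal (thermalEntropy_nonneg hn)]
  exact bijOn_thermalEntropy.invOn_invFunOn.1 hn

theorem hasEntropyRate_thermalEntropy {N : ℝ → ℝ} (hN : ∀ᶠ s in 𝓝[≥] 0,
      0 ≤ N s ∧ vnEntropy fock (r s) = ENNReal.ofReal (thermalEntropy (N s)))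
    (hpos : 0 < N 0) (hd : HasDerivAt N d 0) :
    HasEntropyRate fock r ((Real.log (N 0 + 1) - Real.log (N 0)) * d : ℝ) := by
  have hderiv : HasDerivAt (fun s => thermalEntropy (N s))
      ((Real.log (N 0 + 1) - Real.log (N 0)) * d) 0 :=
    (hasDerivAt_thermalEntropy hpos).comp 0 hd
  have hslope := (hasDerivWithinAt_iff_tendsto_slope' (by simp)).mp
    (hderiv.hasDerivWithinAt (s := Set.Ioi 0))
  refine ((continuous_coe_real_ereal.tendsto _).comp hslope).congr' ?_
  filter_upwards [hN.filter_mono (nhdsWithin_mono 0 Set.Ioi_subset_Ici_self)] with s hs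
  rw [hs.2, (hN.self_of_nhdsWithin Set.self_mem_Ici).2, EReal.coe_ennreal_ofReal,
    EReal.coe_ennreal_ofReal, max_eq_left (thermalEntropy_nonneg hs.1),
    max_eq_left (thermalEntropy_nonneg hpos.le), ← EReal.coe_sub, ← EReal.coe_div]
  simp [slope_def_field]

theorem hasEntropyRate_thermal (fock : HilbertBasis ℕ ℂ H) (hγp : 0 ≤ γp) (hn : 0 < n) :
    HasEntropyRate fock (fun s => thermal fock (meanPhotons γp γm n s))
      ((Real.log (n + 1) - Real.log n) * (γp * (n + 1) - γm * n) : ℝ) := by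
  have hrate := hasEntropyRate_thermalEntropy (fock := fock) (N := meanPhotons γp γm n)
    (r := fun s => thermal fock (meanPhotons γp γm n s))
    (eventually_mem_nhdsWithin.mono fun s hs =>
      ⟨meanPhotons_nonneg hγp hn.le hs, vnEntropy_thermal fock (meanPhotons_nonneg hγp hn.le hs)⟩)
    (by rwa [meanPhotons_zero]) (hasDerivAt_meanPhotons γp γm n 0)
  rwa [meanPhotons_zero] at hrate

theorem InfinitesimalMinOutputEntropy.le_deriv_of_pos
    (hinf : InfinitesimalMinOutputEntropy fock γp γm) (hγp : 0 ≤ γp) (hr : IsOrbit fock γp γm r)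
    {N : ℝ → ℝ} (ht : 0 ≤ t)
    (hN : ∀ᶠ s in 𝓝 t, 0 ≤ N s ∧ vnEntropy fock (r s) = ENNReal.ofReal (thermalEntropy (N s)))
    (hpos : 0 < N t) (hd : HasDerivAt N d t) :
    γp * (N t + 1) - γm * N t ≤ d := by
  have hrate : HasEntropyRate fock (fun s => r (t + s))
      ((Real.log (N t + 1) - Real.log (N t)) * d : ℝ) := by
    have hshift : Tendsto (fun s => t + s) (𝓝[≥] 0) (𝓝 t) :=
      ((continuous_const_add t).tendsto' 0 t (add_zero t)).mono_left nhdsWithin_le_nhds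
    simpa using hasEntropyRate_thermalEntropy (N := fun s => N (t + s)) (hshift.eventually hN)
      (by simpa using hpos) (HasDerivAt.comp_const_add t 0 (by simpa using hd))
  have hSpos : 0 < thermalEntropy (N t) := by
    simpa only [thermalEntropy_zero] using strictMonoOn_thermalEntropy Set.self_mem_Ici hpos.le hpos
  have hle := hinf _ hSpos (N t) hpos.le rfl _ _ (hr.comp_const_add ht)
    (by simpa using hN.self_of_nhds.2) (isOrbit_thermal fock hγp hpos.le)
    (by simp only [meanPhotons_zero]) _ _ hrate (hasEntropyRate_thermal fock hγp hpos)
  exact le_of_mul_le_mul_left (EReal.coe_le_coe_iff.mp hle)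
    ((by positivity : 0 < 1 / (N t + 1)).trans_le (one_div_le_log_sub_log hpos))

theorem InfinitesimalMinOutputEntropy.le_deriv_effectivePhotons
    (hinf : InfinitesimalMinOutputEntropy fock γp γm) (hγp : 0 ≤ γp) (hγm : 0 ≤ γm)
    (hr : IsOrbit fock γp γm r) (ht : 0 < t) (hfin : ∀ᶠ s in 𝓝 t, vnEntropy fock (r s) ≠ ⊤)
    (hd : HasDerivAt (fun s => effectivePhotons fock (r s)) d t) :
    γp * (effectivePhotons fock (r t) + 1) - γm * effectivePhotons fock (r t) ≤ d := by
  rcases (effectivePhotons_nonneg (fock := fock) (ρ := r t)).eq_or_lt with hzero | hpos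
  · have hd0 : d = 0 := IsLocalMin.hasDerivAt_eq_zero
      (.of_forall fun s => hzero ▸ effectivePhotons_nonneg) hd
    have hpure : vnEntropy fock (r t) = 0 := by
      rw [vnEntropy_eq_ofReal_effectivePhotons hfin.self_of_nhds, ← hzero, thermalEntropy_zero,
        ENNReal.ofReal_zero]
    rcases hγp.eq_or_lt with rfl | hγp
    · rw [← hzero, hd0]
      simp
    · exact absurd hpure (hr.vnEntropy_ne_zero hγp hγm ht)
  · exact hinf.le_deriv_of_pos (N := fun s => effectivePhotons fock (r s)) hγp hr ht.le
      (hfin.mono fun s hs => ⟨effectivePhotons_nonneg, vnEntropy_eq_ofReal_effectivePhotons hs⟩)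
      hpos hd

theorem DescentRateLE.of_thermalEntropy {N : ℝ → ℝ} {k : ℝ}
    (hg : DescentRateLE (fun s => thermalEntropy (N s)) k (Set.Icc 0 T)) (hN : ∀ s, 0 ≤ N s) :
    ∃ K, DescentRateLE N K (Set.Icc 0 T) := by
  obtain ⟨B, hB0, hB⟩ : ∃ B, 0 ≤ B ∧ ∀ s ∈ Set.Icc 0 T, N s ≤ B :=
    ⟨Real.exp _, Real.exp_nonneg _, fun s hs => by
      have hexp := (Real.log_le_iff_le_exp (by linarith [hN s])).mp
        ((log_add_one_le_thermalEntropy (hN s)).trans ((le_abs_self _).trans (hg.abs_le hs)))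
      linarith⟩
  refine ⟨|k| * (B + 1), fun s hs t ht hst => ?_⟩
  have hts : 0 ≤ t - s := sub_nonneg.mpr hst
  rcases le_total (N s) (N t) with hle | hle
  · have : 0 ≤ |k| * (B + 1) * (t - s) := by positivity
    linarith
  · have hchord := sub_div_le_thermalEntropy_sub (hN t) hle (hB s hs)
    have hslope : (N s - N t) / (B + 1) ≤ |k| * (t - s) := by
      linarith [hg s hs t ht hst, mul_le_mul_of_nonneg_right (le_abs_self k) hts]
    rw [div_le_iff₀ (by linarith)] at hslope
    linarith

theorem IsOrbit.vnEntropy_ne_top (hγp : 0 ≤ γp) (hγm : 0 ≤ γm) (hr : IsOrbit fock γp γm r)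
    (hs : 0 ≤ s) (hst : s ≤ t) (hfin : vnEntropy fock (r t) ≠ ⊤) : vnEntropy fock (r s) ≠ ⊤ :=
  ne_top_of_le_ne_top (ENNReal.add_ne_top.mpr ⟨hfin, ENNReal.ofReal_ne_top⟩)
    (hr.vnEntropy_le hγp hγm hs hst)

theorem IsOrbit.descentRateLE_thermalEntropy (hγp : 0 ≤ γp) (hγm : 0 ≤ γm)
    (hr : IsOrbit fock γp γm r) (hfin : vnEntropy fock (r T) ≠ ⊤) :
    DescentRateLE (fun s => thermalEntropy (effectivePhotons fock (r s))) |γm - γp|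
      (Set.Icc 0 T) := fun s hs t ht hst => by
  have hle := hr.vnEntropy_le hγp hγm hs.1 hst
  have hg : 0 ≤ thermalEntropy (effectivePhotons fock (r t)) :=
    thermalEntropy_nonneg effectivePhotons_nonneg
  have hdrift : 0 ≤ |γm - γp| * (t - s) := mul_nonneg (abs_nonneg _) (sub_nonneg.mpr hst)
  rwa [vnEntropy_eq_ofReal_effectivePhotons (hr.vnEntropy_ne_top hγp hγm hs.1 hs.2 hfin),
    vnEntropy_eq_ofReal_effectivePhotons (hr.vnEntropy_ne_top hγp hγm ht.1 ht.2 hfin),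
    ← ENNReal.ofReal_add hg hdrift, ENNReal.ofReal_le_ofReal_iff (add_nonneg hg hdrift)] at hle

theorem IsOrbit.exists_descentRateLE_effectivePhotons (hγp : 0 ≤ γp) (hγm : 0 ≤ γm)
    (hr : IsOrbit fock γp γm r) (hfin : vnEntropy fock (r T) ≠ ⊤) :
    ∃ K, DescentRateLE (fun s => effectivePhotons fock (r s)) K (Set.Icc 0 T) :=
  (hr.descentRateLE_thermalEntropy hγp hγm hfin).of_thermalEntropy
    fun _ => effectivePhotons_nonneg

theorem exists_lipschitzOnWith_meanPhotons (γp γm n T : ℝ) :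
    ∃ L, LipschitzOnWith L (meanPhotons γp γm n) (Set.Icc 0 T) := by
  have hderiv := hasDerivAt_meanPhotons γp γm n
  have hcont : Continuous (meanPhotons γp γm n) :=
    continuous_iff_continuousAt.mpr fun t => (hderiv t).continuousAt
  have hC1 : ContDiff ℝ 1 (meanPhotons γp γm n) := contDiff_one_iff_deriv.mpr
    ⟨fun t => (hderiv t).differentiableAt, by
      rw [funext fun t => (hderiv t).deriv]
      fun_prop⟩
  exact hC1.contDiffOn.exists_lipschitzOnWith one_ne_zero (convex_Icc 0 T) isCompact_Icc

theorem InfinitesimalMinOutputEntropy.meanPhotons_le_effectivePhotons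
    (hinf : InfinitesimalMinOutputEntropy fock γp γm) (hγp : 0 ≤ γp) (hγm : 0 ≤ γm)
    (hr : IsOrbit fock γp γm r) (hT : 0 ≤ T) (hfin : vnEntropy fock (r T) ≠ ⊤) :
    meanPhotons γp γm (effectivePhotons fock (r 0)) T ≤ effectivePhotons fock (r T) := by
  obtain ⟨K, hN⟩ := hr.exists_descentRateLE_effectivePhotons hγp hγm hfin
  obtain ⟨L, hL⟩ := exists_lipschitzOnWith_meanPhotons γp γm (effectivePhotons fock (r 0)) T
  have hgap := (hN.sub hL).nonneg_of_gronwall (c := γm - γp) hT (by simp [meanPhotons_zero])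
    fun t ht d hd => by
      have hfin_near : ∀ᶠ s in 𝓝 t, vnEntropy fock (r s) ≠ ⊤ := by
        filter_upwards [Icc_mem_nhds ht.1 ht.2] with s hs
        exact hr.vnEntropy_ne_top hγp hγm hs.1 hs.2 hfin
      have hderiv := hd.fun_add (hasDerivAt_meanPhotons γp γm (effectivePhotons fock (r 0)) t)
      simp only [sub_add_cancel] at hderiv
      linarith [hinf.le_deriv_effectivePhotons hγp hγm hr ht.1 hfin_near hderiv]
  exact sub_nonneg.mp hgap

end EffectivePhotons

end

theorem mainTheorem2 {H : Type*} [NormedAddCommGroup H] [InnerProductSpace ℂ H] [CompleteSpace H]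
    (fock : HilbertBasis ℕ ℂ H) (γp γm : ℝ) (hγp : 0 ≤ γp) (hγm : 0 ≤ γm) :
    InfinitesimalMinOutputEntropy fock γp γm → MinOutputEntropy fock γp γm := by
  rintro hinf _ - nbar hnbar rfl r rth hr hr0 hrth hrth0 T hT
  have hthermal : rth T = thermal fock (meanPhotons γp γm nbar T) :=
    hrth.eq_of_zero_eq hγp hγm (isOrbit_thermal fock hγp hnbar)
      (by rw [hrth0, meanPhotons_zero]) hT
  have hm : 0 ≤ meanPhotons γp γm nbar T := meanPhotons_nonneg hγp hnbar hT
  rw [hthermal, vnEntropy_thermal fock hm]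
  by_cases hfin : vnEntropy fock (r T) = ⊤
  · rw [hfin]
    exact le_top
  have hle := hinf.meanPhotons_le_effectivePhotons hγp hγm hr hT hfin
  rw [effectivePhotons_eq hnbar hr0] at hle
  rw [vnEntropy_eq_ofReal_effectivePhotons hfin]
  exact ENNReal.ofReal_le_ofReal
    (strictMonoOn_thermalEntropy.monotoneOn hm effectivePhotons_nonneg hle)
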